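/- Let $0<k<n$ and $r\ge 0$ be integers. Discrete side. For a real $k\times n$ matrix $M$ with columns $v_1,\dots,v_n\in\mathbb{R}^k$ and $J=\{j_1<\dots<j_k\}\subset\{1,\dots,n\}$ put $m_J(M)=\det(v_{j_1},\dots,v_{j_k})$ and $m_\bullet=m_{\{1,\dots,k\}}$; let $\mathcal{C}^\ast$ be the set of real $k\times n$ matrices $M$ with $m_J(M)\ne 0$ for all $J$ with $|J|=k$. There is a positive elementary move from $M_0$ to $M_1$ if, for some $1\le j<n$ and some $t>0$, $M_1$ is obtained from $M_0$ by replacing the column $v_j$ by $v_j+t\,v_{j+1}$. A finite sequence $\mathbf{M}=(M_s)_{0\le s\le \ell}$ in $\mathcal{C}^\ast$ is convex if for every $s<\ell$ there is a positive elementary move from $M_s$ to $M_{s+1}$, and $\operatorname{nsc}(\mathbf{M})=|\{s\in\mathbb{Z} : 0\le s<\ell,\ m_\bullet(M_s)\,m_\bullet(M_{s+1})<0\}|$. Continuous side. Let $\operatorname{Lo}_n^1$ be the group of real lower triangular $n\times n$ matrices with unit diagonal, let $\mathfrak{l}_j=e_{j+1}e_j^\top$ for $1\le j<n$, and for $L\in\operatorname{Lo}_n^1$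 let $m_\bullet(L)$ be the determinant of the $k\times k$ submatrix in the last $k$ rows and first $k$ columns of $L$. A smooth curve $\Gamma:[a,b]\to\operatorname{Lo}_n^1$ with $a<b$ is convex if there are smooth functions $\beta_j:[a,b]\to(0,+\infty)$, $1\le j<n$, with $\Gamma(t)^{-1}\Gamma'(t)=\sum_j\beta_j(t)\,\mathfrak{l}_j$ for all $t\in[a,b]$. Let $\operatorname{nz}(\Gamma)$ be the number of zeros of $m_\bullet\circ\Gamma$ in $[a,b]$, counted without multiplicity. Then $\operatorname{nsc}(\mathbf{M})\le r$ for every convex sequence $\mathbf{M}$ in $\mathcal{C}^\ast$ (of any length) if and only if $\operatorname{nz}(\Gamma)\le r$ for every smooth convex curve $\Gamma$ in $\operatorname{Lo}_n^1$ (on any interval $[a,b]$). In particular, for $r=k(n-k)$, the discrete and continuous forms of the Grassmann convexity conjecture are equivalent. -/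

import Mathlib

open scoped ContDiff

namespace GrassmannConvexity

/-! ### Minors of `k × n` matrices -/

/-- The maximal minor `m_J(M) = det(v_{j₁}, …, v_{j_k})` of a `k × n` matrix. A `k`-element set
`J = {j₁ < ⋯ < j_k}` of column indices is given by its increasing enumeration. -/
noncomputable def minor {k n : ℕ} (J : Fin k ↪o Fin n) (M : Matrix (Fin k) (Fin n) ℝ) : ℝ :=
  (M.submatrix id J).det

/-- `m_• = m_{1, …, k}`, the minor on the first `k` columns. -/
noncomputable def minorBullet {k n : ℕ} (h : k ≤ n) (M : Matrix (Fin k) (Fin n) ℝ) : ℝ :=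
  minor (Fin.castLEOrderEmb h) M

/-- The set `𝒞*` of `k × n` matrices all of whose maximal minors are nonzero. -/
def generic (k n : ℕ) : Set (Matrix (Fin k) (Fin n) ℝ) :=
  {M | ∀ J : Fin k ↪o Fin n, minor J M ≠ 0}

/-! ### The discrete model -/

/-- There is a positive elementary move from `M₀` to `M₁`: some column `v_j` (not the last one)
is replaced by `v_j + t v_{j+1}` with `t > 0`, and the other columns are unchanged. -/
def PositiveMove {k n : ℕ} (M₀ M₁ : Matrix (Fin k) (Fin n) ℝ) : Prop :=
  ∃ (j : ℕ) (hj : j + 1 < n) (t : ℝ), 0 < t ∧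
    (∀ i, M₁ i ⟨j, by omega⟩ = M₀ i ⟨j, by omega⟩ + t * M₀ i ⟨j + 1, hj⟩) ∧
    ∀ j' : Fin n, (j' : ℕ) ≠ j → ∀ i, M₁ i j' = M₀ i j'

/-- The finite sequence `(M_s)_{0 ≤ s ≤ ℓ}` is convex. (Values `M s` with `s > ℓ` are
irrelevant.) -/
def IsConvexSeq {k n : ℕ} (ℓ : ℕ) (M : ℕ → Matrix (Fin k) (Fin n) ℝ) : Prop :=
  ∀ s < ℓ, PositiveMove (M s) (M (s + 1))

/-- `nsc(M)`: the number of sign changes of `m_•` along the sequence `(M_s)_{0 ≤ s ≤ ℓ}`. -/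
noncomputable def nsc {k n : ℕ} (h : k ≤ n) (ℓ : ℕ) (M : ℕ → Matrix (Fin k) (Fin n) ℝ) : ℕ :=
  {s : ℕ | s < ℓ ∧ minorBullet h (M s) * minorBullet h (M (s + 1)) < 0}.ncard

/-! ### The continuous model -/

/-- The group `Lo_n^1` of real lower triangular matrices with unit diagonal, as a set of
matrices. -/
def unipotentLower (n : ℕ) : Set (Matrix (Fin n) (Fin n) ℝ) :=
  {L | (∀ i j, i < j → L i j = 0) ∧ ∀ i, L i i = 1}

/-- The matrix `𝔩_j = e_{j+1} e_jᵀ`, for each of the `n - 1` subdiagonal positions. -/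
def subdiag (n : ℕ) (j : Fin (n - 1)) : Matrix (Fin n) (Fin n) ℝ :=
  Matrix.single ⟨j + 1, by omega⟩ ⟨j, by omega⟩ 1

/-- The `k × n` submatrix formed by the last `k` rows of an `n × n` matrix. -/
def lastRows {k n : ℕ} (h : k ≤ n) (L : Matrix (Fin n) (Fin n) ℝ) : Matrix (Fin k) (Fin n) ℝ :=
  L.submatrix (fun i : Fin k => (⟨n - k + i, by omega⟩ : Fin n)) id

/-- The entrywise derivative within `[a, b]` (one-sided at the endpoints) of a matrix curve. -/
noncomputable def curveDeriv {n : ℕ} (a b : ℝ) (Γ : ℝ → Matrix (Fin n) (Fin n) ℝ) (t : ℝ) :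
    Matrix (Fin n) (Fin n) ℝ :=
  Matrix.of fun i j => derivWithin (fun s => Γ s i j) (Set.Icc a b) t

/-- `Γ` restricted to `[a, b]` is a smooth convex curve in `Lo_n^1`. (Values of `Γ` outside
`[a, b]` are irrelevant.) -/
structure IsConvexCurve {n : ℕ} (a b : ℝ) (Γ : ℝ → Matrix (Fin n) (Fin n) ℝ) : Prop where
  mem : ∀ t ∈ Set.Icc a b, Γ t ∈ unipotentLower n
  smooth : ∀ i j, ContDiffOn ℝ ∞ (fun t => Γ t i j) (Set.Icc a b)
  logDeriv : ∃ β : Fin (n - 1) → ℝ → ℝ,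
    (∀ j, ContDiffOn ℝ ∞ (β j) (Set.Icc a b)) ∧
    (∀ j, ∀ t ∈ Set.Icc a b, 0 < β j t) ∧
    ∀ t ∈ Set.Icc a b, (Γ t)⁻¹ * curveDeriv a b Γ t = ∑ j, β j t • subdiag n j

/-- `nz(Γ)`: the number of zeros (without multiplicity) of `m_• ∘ Γ` on `[a, b]`, where `m_•(L)`
is the lower-left `k × k` minor of `L`; it equals `⊤` if there are infinitely many zeros. -/
noncomputable def nz {k n : ℕ} (h : k ≤ n) (a b : ℝ) (Γ : ℝ → Matrix (Fin n) (Fin n) ℝ) : ℕ∞ :=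
  {t : ℝ | t ∈ Set.Icc a b ∧ minorBullet h (lastRows h (Γ t)) = 0}.encard

end GrassmannConvexity

namespace GrassmannConvexity

/-! ### Column moves and the positive cell -/

/-! Both directions compare positive elementary moves with convex curves through the open cell of
unipotent matrices that are products of positive elementary factors.

From a curve to a sequence: along a convex curve, `(Γ t)⁻¹ * Γ t'` with `t < t'` lies in the cell
(`IsConvexCurve.inv_mul_mem_positiveCell`), and a cell element is reached from the identity by
positive moves (`reaches_of_mem_positiveCell`). Since the cell is open, the points of the curve at
`r + 1` zeros of `m_•` can be perturbed independently and remain joined by moves. Near a zero `m_•`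
takes both signs, even if the curve itself only touches zero, because a determinant is affine in
each diagonal entry (`frequently_mul_minorBullet_pos`). Alternating signs, with one more point added
at the end, give `r + 1` sign changes. Replacing the selector of the last `k` rows by a generic
nearby `k × n` matrix puts every term in `𝒞*`.

From a sequence to a curve: the first matrix is `A * lastRows L` with `A` invertible and `L`
unipotent. A move is the time-one effect of a single `β_j` given by a bump. Adding a small `ε > 0`
to every `β_j` makes the curve convex and keeps the strict signs at integer times
(`exists_family_of_moves`); the intermediate value theorem then yields a zero for each sign change.
-/

/-- The analogue of `PositiveMove` for matrices with an arbitrary row index type. -/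
def ColumnMove {ι : Type*} {n : ℕ} (A B : Matrix ι (Fin n) ℝ) : Prop :=
  ∃ (j : ℕ) (hj : j + 1 < n) (t : ℝ), 0 < t ∧
    (∀ i, B i ⟨j, by omega⟩ = A i ⟨j, by omega⟩ + t * A i ⟨j + 1, hj⟩) ∧
    ∀ j' : Fin n, (j' : ℕ) ≠ j → ∀ i, B i j' = A i j'

/-- `B` is obtained from `A` by finitely many positive elementary moves. -/
abbrev Reaches {ι : Type*} {n : ℕ} : Matrix ι (Fin n) ℝ → Matrix ι (Fin n) ℝ → Prop :=
  Relation.ReflTransGen ColumnMove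

lemma ColumnMove.mul_left {ι κ : Type*} [Fintype ι] {n : ℕ} {A B : Matrix ι (Fin n) ℝ}
    (h : ColumnMove A B) (E : Matrix κ ι ℝ) : ColumnMove (E * A) (E * B) := by
  obtain ⟨j, hj, t, ht, h1, h2⟩ := h
  refine ⟨j, hj, t, ht, fun i => ?_, fun j' hj' i => ?_⟩
  · simp only [Matrix.mul_apply, h1, Finset.mul_sum, ← Finset.sum_add_distrib]
    exact Finset.sum_congr rfl fun x _ => by ring
  · simp only [Matrix.mul_apply, h2 j' hj']

lemma Reaches.mul_left {ι κ : Type*} [Fintype ι] {n : ℕ} {A B : Matrix ι (Fin n) ℝ}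
    (h : Reaches A B) (E : Matrix κ ι ℝ) : Reaches (E * A) (E * B) :=
  Relation.ReflTransGen.lift (fun X => E * X) (fun _ _ h => ColumnMove.mul_left h E) _ _ h

/-- One step of Neville elimination: subtract from each column the multiple of the next one that
clears the last row, then drop the last row and column. -/
noncomputable def eliminate {m : ℕ} (L : Matrix (Fin (m + 1)) (Fin (m + 1)) ℝ) :
    Matrix (Fin m) (Fin m) ℝ :=
  Matrix.of fun i j => L i.castSucc j.castSucc -
    L (Fin.last m) j.castSucc / L (Fin.last m) j.succ * L i.castSucc j.succ

/-- The matrices for which Neville elimination runs through with positive multipliers. -/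
def positiveCell : (n : ℕ) → Set (Matrix (Fin n) (Fin n) ℝ)
  | 0 => Set.univ
  | m + 1 => {L | (∀ j, 0 < L (Fin.last m) j) ∧ eliminate L ∈ positiveCell m}

lemma eliminate_mem_unipotentLower {m : ℕ} {L : Matrix (Fin (m + 1)) (Fin (m + 1)) ℝ}
    (hL : L ∈ unipotentLower (m + 1)) : eliminate L ∈ unipotentLower m := by
  refine ⟨fun i j hij => ?_, fun i => ?_⟩
  · have h1 : L i.castSucc j.castSucc = 0 := hL.1 _ _ (by simpa using hij)
    have h2 : L i.castSucc j.succ = 0 :=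
      hL.1 _ _ ((Fin.castSucc_lt_castSucc_iff.2 hij).trans (by simp [Fin.lt_def]))
    simp [eliminate, h1, h2]
  · have h2 : L i.castSucc i.succ = 0 := hL.1 _ _ (by simp [Fin.lt_def])
    simp [eliminate, h2, hL.2]

/-- The recursive description imposes only strict inequalities, and elimination is continuous where
the last row is positive. This openness is what permits independent perturbations of points on a
curve. -/
lemma isOpen_positiveCell (n : ℕ) : IsOpen (positiveCell n) := by
  induction n with
  | zero => exact isOpen_univ
  | succ m ih =>
    have hopen : IsOpen {L : Matrix (Fin (m + 1)) (Fin (m + 1)) ℝ | ∀ j, 0 < L (Fin.last m) j} := by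
      simp only [Set.ofPred_forall]
      refine isOpen_iInter_of_finite fun j => ?_
      exact isOpen_lt continuous_const (continuous_id.matrix_elem _ _)
    have hcont : ContinuousOn (eliminate (m := m))
        {L : Matrix (Fin (m + 1)) (Fin (m + 1)) ℝ | ∀ j, 0 < L (Fin.last m) j} := by
      refine continuousOn_pi.2 fun i => continuousOn_pi.2 fun j => ?_
      have hc : ∀ i j, ContinuousOn (fun L : Matrix (Fin (m + 1)) (Fin (m + 1)) ℝ => L i j)
          {L | ∀ j, 0 < L (Fin.last m) j} :=
        fun i j => (continuous_id.matrix_elem i j).continuousOn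
      exact (hc _ _).sub (((hc _ _).div (hc _ _) fun L hL => (hL _).ne').mul (hc _ _))
    exact hcont.isOpen_inter_preimage hopen ih

/-- The block matrix `diag(K, 1)`. -/
def bordered {m : ℕ} (K : Matrix (Fin m) (Fin m) ℝ) : Matrix (Fin (m + 1)) (Fin (m + 1)) ℝ :=
  Fin.snoc (α := fun _ => Fin (m + 1) → ℝ)
    (fun i => Fin.snoc (α := fun _ => ℝ) (K i) 0) (Fin.snoc (α := fun _ => ℝ) 0 1)

section bordered
variable {m : ℕ} (K : Matrix (Fin m) (Fin m) ℝ)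

@[simp] lemma bordered_castSucc_castSucc (i j : Fin m) :
    bordered K i.castSucc j.castSucc = K i j := by simp [bordered]

@[simp] lemma bordered_castSucc_last (i : Fin m) :
    bordered K i.castSucc (Fin.last m) = 0 := by simp [bordered]

@[simp] lemma bordered_last_castSucc (j : Fin m) :
    bordered K (Fin.last m) j.castSucc = 0 := by simp [bordered]

@[simp] lemma bordered_last_last :
    bordered K (Fin.last m) (Fin.last m) = 1 := by simp [bordered]

lemma bordered_one : bordered (1 : Matrix (Fin m) (Fin m) ℝ) = 1 := by
  ext i j
  induction i using Fin.lastCases <;> induction j using Fin.lastCases <;>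
    simp [Matrix.one_apply, Fin.ext_iff]
  · omega
  · omega

end bordered

lemma ColumnMove.bordered {m : ℕ} {A B : Matrix (Fin m) (Fin m) ℝ} (h : ColumnMove A B) :
    ColumnMove (bordered A) (bordered B) := by
  obtain ⟨j, hj, t, ht, h1, h2⟩ := h
  refine ⟨j, by omega, t, ht, fun i => ?_, fun j' hj' i => ?_⟩
  · change GrassmannConvexity.bordered B i (Fin.castSucc ⟨j, by omega⟩) =
      GrassmannConvexity.bordered A i (Fin.castSucc ⟨j, by omega⟩) +
        t * GrassmannConvexity.bordered A i (Fin.castSucc ⟨j + 1, hj⟩)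
    induction i using Fin.lastCases with
    | last => simp only [bordered_last_castSucc, mul_zero, add_zero]
    | cast i => simp only [bordered_castSucc_castSucc, h1]
  · induction i using Fin.lastCases <;> induction j' using Fin.lastCases <;> simp
    exact h2 _ (by simpa using hj') _

lemma reaches_of_mem_positiveCell {n : ℕ} {L : Matrix (Fin n) (Fin n) ℝ}
    (hL : L ∈ unipotentLower n) (hp : L ∈ positiveCell n) : Reaches 1 L := by
  induction n with
  | zero => rw [Subsingleton.elim L 1]
  | succ m ih =>
    obtain ⟨hpos, hK⟩ := hp
    have h1 : Reaches 1 (bordered (eliminate L)) := by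
      rw [← bordered_one]
      exact Relation.ReflTransGen.lift bordered (fun _ _ h => ColumnMove.bordered h) _ _
        (ih (eliminate_mem_unipotentLower hL) hK)
    -- Elimination is undone from right to left: in `C p` the columns from `p` on are already those
    -- of `L`. Passing from `C (p + 1)` to `C p` restores column `p` by adding the eliminated
    -- multiple of column `p + 1`.
    let C : ℕ → Matrix (Fin (m + 1)) (Fin (m + 1)) ℝ := fun p i j =>
      if p ≤ (j : ℕ) then L i j else bordered (eliminate L) i j
    have hCm : C m = bordered (eliminate L) := by
      ext i j
      induction j using Fin.lastCases with
      | last =>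
        induction i using Fin.lastCases with
        | last => simp [C, hL.2]
        | cast i => simpa [C] using hL.1 _ _ (Fin.castSucc_lt_last i)
      | cast j => simp only [C, Fin.val_castSucc, if_neg (not_le.2 j.2)]
    have hC0 : C 0 = L := by ext i j; simp [C]
    have hstep : ∀ p < m, ColumnMove (C (p + 1)) (C p) := by
      intro p hp
      refine ⟨p, by omega, L (Fin.last m) (Fin.castSucc ⟨p, hp⟩) / L (Fin.last m)
        (Fin.succ ⟨p, hp⟩), div_pos (hpos _) (hpos _), fun i => ?_, fun j' hj' i => ?_⟩
      · have e1 : C p i ⟨p, by omega⟩ = L i (Fin.castSucc ⟨p, hp⟩) := by simp [C]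
        have e2 : C (p + 1) i ⟨p + 1, by omega⟩ = L i (Fin.succ ⟨p, hp⟩) := by simp [C]
        have e3 : C (p + 1) i ⟨p, by omega⟩ =
            bordered (eliminate L) i (Fin.castSucc ⟨p, hp⟩) := by simp [C]
        rw [e1, e2, e3]
        induction i using Fin.lastCases with
        | last =>
          have := (hpos (Fin.succ ⟨p, hp⟩)).ne'
          rw [bordered_last_castSucc]; field_simp; simp
        | cast i => rw [bordered_castSucc_castSucc]; simp only [eliminate, Matrix.of_apply]; ring
      · have : (p + 1 ≤ (j' : ℕ)) ↔ p ≤ (j' : ℕ) := by omega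
        simp only [C, this]
    have h2 : ∀ p ≤ m, Reaches (C m) (C (m - p)) := by
      intro p hp
      induction p with
      | zero => exact .refl
      | succ p ih =>
        refine (ih (by omega)).tail ?_
        have := hstep (m - (p + 1)) (by omega)
        rwa [show m - (p + 1) + 1 = m - p by omega] at this
    have h3 := h2 m le_rfl
    rw [Nat.sub_self, hC0, hCm] at h3
    exact h1.trans h3

/-! ### The group of unipotent lower triangular matrices -/

lemma det_eq_one_of_mem_unipotentLower {n : ℕ} {L : Matrix (Fin n) (Fin n) ℝ}
    (hL : L ∈ unipotentLower n) : L.det = 1 := by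
  rw [Matrix.det_of_isLowerTriangular (M := L) fun i j h => hL.1 i j (by simpa using h)]
  simp [hL.2]

lemma isUnit_det_of_mem_unipotentLower {n : ℕ} {L : Matrix (Fin n) (Fin n) ℝ}
    (hL : L ∈ unipotentLower n) : IsUnit L.det := by
  simp [det_eq_one_of_mem_unipotentLower hL]

lemma mul_mem_unipotentLower {n : ℕ} {A B : Matrix (Fin n) (Fin n) ℝ}
    (hA : A ∈ unipotentLower n) (hB : B ∈ unipotentLower n) : A * B ∈ unipotentLower n := by
  have key : ∀ i j x, i ≤ j → x ≠ i → A i x * B x j = 0 := by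
    intro i j x hij hx
    rcases lt_or_gt_of_ne hx with h | h
    · rw [hB.1 x j (h.trans_le hij), mul_zero]
    · rw [hA.1 i x h, zero_mul]
  refine ⟨fun i j hij => ?_, fun i => ?_⟩
  · rw [Matrix.mul_apply, Finset.sum_eq_single i (fun x _ hx => key i j x hij.le hx) (by simp),
      hB.1 i j hij, mul_zero]
  · rw [Matrix.mul_apply, Finset.sum_eq_single i (fun x _ hx => key i i x le_rfl hx) (by simp),
      hA.2, hB.2, mul_one]

lemma inv_mem_unipotentLower {n : ℕ} {A : Matrix (Fin n) (Fin n) ℝ}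
    (hA : A ∈ unipotentLower n) : A⁻¹ ∈ unipotentLower n := by
  have hu := isUnit_det_of_mem_unipotentLower hA
  have : Invertible A := A.invertibleOfIsUnitDet hu
  have hbt : Matrix.BlockTriangular A OrderDual.toDual := fun i j h => hA.1 i j (by simpa using h)
  have hinv := Matrix.blockTriangular_inv_of_blockTriangular hbt
  have h0 : ∀ i j, i < j → A⁻¹ i j = 0 := fun i j h => hinv (by simpa using h)
  refine ⟨h0, fun i => ?_⟩
  have h1 : (A * A⁻¹) i i = 1 := by rw [Matrix.mul_nonsing_inv _ hu]; simp
  rw [Matrix.mul_apply, Finset.sum_eq_single i (fun x _ hx => ?_) (by simp), hA.2, one_mul] at h1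
  · exact h1
  · rcases lt_or_gt_of_ne hx with h | h
    · rw [h0 x i h, mul_zero]
    · rw [hA.1 i x h, zero_mul]

lemma continuousAt_inv_mul {n : ℕ} {P Q : Matrix (Fin n) (Fin n) ℝ} (hP : IsUnit P.det) :
    ContinuousAt (fun X : Matrix (Fin n) (Fin n) ℝ × Matrix (Fin n) (Fin n) ℝ =>
      X.1⁻¹ * X.2) (P, Q) := by
  have h : ContinuousAt (fun X : Matrix (Fin n) (Fin n) ℝ × Matrix (Fin n) (Fin n) ℝ =>
      X.1⁻¹) (P, Q) := by
    simp only [Matrix.inv_def, Ring.inverse_eq_inv']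
    exact ContinuousAt.smul
      (ContinuousAt.inv₀ (Continuous.matrix_det continuous_fst).continuousAt hP.ne_zero)
      (Continuous.matrix_adjugate continuous_fst).continuousAt
  exact (Continuous.matrix_mul continuous_fst continuous_snd).continuousAt.comp
    (f := fun X : Matrix (Fin n) (Fin n) ℝ × Matrix (Fin n) (Fin n) ℝ => (X.1⁻¹, X.2))
    (h.prodMk continuousAt_snd)

/-- Reachability through the positive cell is stable under perturbation of both ends. -/
lemma eventually_reaches {n : ℕ} {P Q : Matrix (Fin n) (Fin n) ℝ}
    (hP : P ∈ unipotentLower n) (h : P⁻¹ * Q ∈ positiveCell n) :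
    ∀ᶠ X : Matrix (Fin n) (Fin n) ℝ × Matrix (Fin n) (Fin n) ℝ in nhds P ×ˢ nhds Q,
      X.1 ∈ unipotentLower n → X.2 ∈ unipotentLower n → Reaches X.1 X.2 := by
  rw [← nhds_prod_eq]
  have hc := continuousAt_inv_mul (Q := Q) (isUnit_det_of_mem_unipotentLower hP)
  filter_upwards [hc.eventually ((isOpen_positiveCell n).mem_nhds h)] with X hX h1 h2
  have := (reaches_of_mem_positiveCell
    (mul_mem_unipotentLower (inv_mem_unipotentLower h1) h2) hX).mul_left X.1
  rwa [mul_one, Matrix.mul_nonsing_inv_cancel_left _ _ (isUnit_det_of_mem_unipotentLower h1)]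
    at this

/-! ### Convex curves issuing from the identity lie in the positive cell -/

/-- A continuous curve in `Lo_n^1` issuing from the identity and convex in the open interval. -/
structure ConvexFromOne {n : ℕ} (a b : ℝ) (G : ℝ → Matrix (Fin n) (Fin n) ℝ)
    (β : ℕ → ℝ → ℝ) : Prop where
  start : G a = 1
  mem : ∀ u ∈ Set.Icc a b, G u ∈ unipotentLower n
  cont : ∀ i j, ContinuousOn (fun u => G u i j) (Set.Icc a b)
  -- Only interior times are constrained: after elimination the coefficients involve quotients that
  -- degenerate at the starting time.
  pos : ∀ j, j + 1 < n → ∀ u ∈ Set.Ioo a b, 0 < β j u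
  deriv : ∀ (i j : Fin n) (hj : (j : ℕ) + 1 < n), ∀ u ∈ Set.Ioo a b,
    HasDerivAt (fun u => G u i j) (β j u * G u i ⟨j + 1, hj⟩) u

namespace ConvexFromOne
variable {n : ℕ} {a b : ℝ} {G : ℝ → Matrix (Fin n) (Fin n) ℝ} {β : ℕ → ℝ → ℝ}

/-- Induction on the distance below the diagonal: each entry starts at zero and its derivative is a
positive multiple of the entry to its right. -/
lemma entry_pos (h : ConvexFromOne a b G β) (d : ℕ) (i j : Fin n) (hd : (i : ℕ) = j + d) :
    ∀ u ∈ Set.Ioc a b, 0 < G u i j := by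
  induction d generalizing j with
  | zero =>
    intro u hu
    have hij : i = j := Fin.ext (by simpa using hd)
    rw [hij, (h.mem u ⟨hu.1.le, hu.2⟩).2]
    exact one_pos
  | succ d ih =>
    intro u hu
    have hj : (j : ℕ) + 1 < n := by omega
    have hmono : StrictMonoOn (fun u => G u i j) (Set.Icc a b) := by
      refine strictMonoOn_of_deriv_pos (convex_Icc a b) (h.cont i j) fun v hv => ?_
      rw [interior_Icc] at hv
      rw [(h.deriv i j hj v hv).deriv]
      exact mul_pos (h.pos j hj v hv) (ih ⟨j + 1, hj⟩ (by simp; omega) v ⟨hv.1, hv.2.le⟩)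
    have h0 : G a i j = 0 := by
      rw [h.start, Matrix.one_apply_ne (fun e => by rw [e] at hd; omega)]
    have := hmono ⟨le_rfl, (hu.1.trans_le hu.2).le⟩ ⟨hu.1.le, hu.2⟩ hu.1
    simpa only [h0] using this

lemma entry_pos' (h : ConvexFromOne a b G β) {i j : Fin n} (hij : j ≤ i) {u : ℝ}
    (hu : u ∈ Set.Ioc a b) : 0 < G u i j :=
  h.entry_pos ((i : ℕ) - j) i j (by have : (j : ℕ) ≤ i := hij; omega) u hu

lemma entry_nonneg (h : ConvexFromOne a b G β) (i j : Fin n) {u : ℝ}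
    (hu : u ∈ Set.Icc a b) : 0 ≤ G u i j := by
  rcases lt_or_ge i j with hij | hij
  · exact ((h.mem u hu).1 i j hij).ge
  · rcases hu.1.eq_or_lt with rfl | ha
    · rw [h.start, Matrix.one_apply]; split_ifs <;> norm_num
    · exact (h.entry_pos' hij ⟨ha, hu.2⟩).le

/-- The difference of the two sides vanishes at the start. In its derivative the terms with `β j`
cancel, leaving a product of nonnegative factors. This bound controls the elimination multipliers at
the starting time. -/
lemma entry_le (h : ConvexFromOne a b G β) (i j : Fin n) (hji : j < i) (hj : (j : ℕ) + 1 < n)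
    {u : ℝ} (hu : u ∈ Set.Icc a b) :
    G u i j ≤ G u ⟨j + 1, hj⟩ j * G u i ⟨j + 1, hj⟩ := by
  set j' : Fin n := ⟨j + 1, hj⟩ with hj'
  have hjj' : j < j' := by simp [hj', Fin.lt_def]
  have hmono : MonotoneOn (fun u => G u j' j * G u i j' - G u i j) (Set.Icc a b) := by
    have key : ∀ v ∈ Set.Ioo a b, ∃ d, 0 ≤ d ∧
        HasDerivAt (fun u => G u j' j * G u i j' - G u i j) d v := by
      intro v hv
      have hv' := Set.Ioo_subset_Icc_self hv
      obtain ⟨e, he, hde⟩ : ∃ e, 0 ≤ e ∧ HasDerivAt (fun u => G u i j') e v := by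
        by_cases hn : (j' : ℕ) + 1 < n
        · exact ⟨_, mul_nonneg (h.pos _ hn v hv).le (h.entry_nonneg _ _ hv'), h.deriv i j' hn v hv⟩
        -- If column `j'` is the last one, the entry in question is diagonal, hence constantly 1.
        · have hij : i = j' := by
            have h1 : (j : ℕ) < i := hji
            have h2 : (j' : ℕ) = j + 1 := rfl
            exact Fin.ext (by omega)
          refine ⟨0, le_rfl, (hasDerivAt_const v (1 : ℝ)).congr_of_eventuallyEq ?_⟩
          filter_upwards [Icc_mem_nhds hv.1 hv.2] with w hw
          rw [hij, (h.mem w hw).2]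
      refine ⟨G v j' j * e, mul_nonneg (h.entry_nonneg _ _ hv') he, ?_⟩
      refine (((h.deriv j' j hj v hv).mul hde).sub (h.deriv i j hj v hv)).congr_deriv ?_
      rw [← hj', (h.mem v hv').2]
      ring
    refine monotoneOn_of_deriv_nonneg (convex_Icc a b)
      (((h.cont _ _).mul (h.cont _ _)).sub (h.cont _ _)) ?_ ?_
    · rw [interior_Icc]
      intro v hv
      obtain ⟨d, -, hd⟩ := key v hv
      exact hd.differentiableAt.differentiableWithinAt
    · rw [interior_Icc]
      intro v hv
      obtain ⟨d, h0, hd⟩ := key v hv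
      rwa [hd.deriv]
  have h0 := hmono ⟨le_rfl, hu.1.trans hu.2⟩ hu hu.1
  simp only [h.start, Matrix.one_apply_ne hjj'.ne', Matrix.one_apply_ne hji.ne'] at h0
  linarith

end ConvexFromOne

lemma eliminate_one (m : ℕ) : eliminate (1 : Matrix (Fin (m + 1)) (Fin (m + 1)) ℝ) = 1 := by
  ext i j
  have : (1 : Matrix (Fin (m + 1)) (Fin (m + 1)) ℝ) (Fin.last m) j.castSucc = 0 :=
    Matrix.one_apply_ne (Fin.castSucc_lt_last j).ne'
  simp only [eliminate, Matrix.of_apply, this, zero_div, zero_mul, sub_zero]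
  simp [Matrix.one_apply]

namespace ConvexFromOne
variable {m : ℕ} {a b : ℝ} {G : ℝ → Matrix (Fin (m + 1)) (Fin (m + 1)) ℝ} {β : ℕ → ℝ → ℝ}

/-- The delicate point is the starting time, where the quotient may be 0/0, with value 0 by
convention. By `entry_le` it is squeezed between 0 and a subdiagonal entry that tends to 0. -/
lemma continuousOn_multiplier (h : ConvexFromOne a b G β) (j : Fin m) :
    ContinuousOn (fun u => G u (Fin.last m) j.castSucc / G u (Fin.last m) j.succ)
      (Set.Icc a b) := by
  intro u hu
  rcases hu.1.eq_or_lt with rfl | ha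
  · have h0 : G a (Fin.last m) j.castSucc = 0 := by
      rw [h.start, Matrix.one_apply_ne (Fin.castSucc_lt_last j).ne']
    have h1 : G a j.succ j.castSucc = 0 := by
      rw [h.start, Matrix.one_apply_ne (by simp [Fin.ext_iff])]
    have hlim : Filter.Tendsto (fun u => G u j.succ j.castSucc) (nhdsWithin a (Set.Icc a b))
        (nhds 0) := h1 ▸ (h.cont j.succ j.castSucc a hu).tendsto
    change Filter.Tendsto _ _ (nhds (G a (Fin.last m) j.castSucc / G a (Fin.last m) j.succ))
    rw [h0, zero_div]
    refine tendsto_of_tendsto_of_tendsto_of_le_of_le' tendsto_const_nhds hlim ?_ ?_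
    · filter_upwards [self_mem_nhdsWithin] with v hv
      exact div_nonneg (h.entry_nonneg _ _ hv) (h.entry_nonneg _ _ hv)
    · filter_upwards [self_mem_nhdsWithin] with v hv
      refine div_le_of_le_mul₀ (h.entry_nonneg _ _ hv) (h.entry_nonneg _ _ hv) ?_
      exact h.entry_le (Fin.last m) j.castSucc (Fin.castSucc_lt_last j) (by simp) hv
  · exact (h.cont _ _ u hu).div (h.cont _ _ u hu)
      (h.entry_pos' (Fin.le_last _) ⟨ha, hu.2⟩).ne'

/-- Neville elimination preserves convexity, so membership in the cell follows by induction on the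
size. -/
lemma eliminate (h : ConvexFromOne a b G β) :
    ∃ γ, ConvexFromOne a b (fun u => eliminate (G u)) γ := by
  let y : ℕ → ℝ → ℝ := fun j u => if hj : j < m then
    G u (Fin.last m) (Fin.castSucc ⟨j, hj⟩) / G u (Fin.last m) (Fin.succ ⟨j, hj⟩) else 0
  -- The multipliers satisfy `y_j' = β_j - β_{j+1} y_j / y_{j+1}`. Substituting this, the `β_j`
  -- terms cancel and the new coefficient is `β_{j+1} y_j / y_{j+1}`.
  refine ⟨fun j u => β (j + 1) u * (y j u / y (j + 1) u), ?_, ?_, ?_, ?_, ?_⟩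
  · simp only [h.start, eliminate_one]
  · exact fun u hu => eliminate_mem_unipotentLower (h.mem u hu)
  · exact fun i j => (h.cont _ _).sub ((h.continuousOn_multiplier j).mul (h.cont _ _))
  · intro j hj u hu
    have hu' : u ∈ Set.Ioc a b := ⟨hu.1, hu.2.le⟩
    have hy : ∀ j, j < m → 0 < y j u := by
      intro j hj
      simp only [y, dif_pos hj]
      exact div_pos (h.entry_pos' (Fin.le_last _) hu') (h.entry_pos' (Fin.le_last _) hu')
    exact mul_pos (h.pos _ (by omega) u hu) (div_pos (hy j (by omega)) (hy _ hj))
  · intro i j hj u hu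
    have hu' : u ∈ Set.Ioc a b := ⟨hu.1, hu.2.le⟩
    let j1 : Fin (m + 1) := j.succ
    let j2 : Fin (m + 1) := ⟨j + 2, by omega⟩
    have d0 : ∀ i, HasDerivAt (fun u => G u i j.castSucc) (β j u * G u i j1) u :=
      fun i => h.deriv i j.castSucc (by simp) u hu
    have d1 : ∀ i, HasDerivAt (fun u => G u i j1) (β (j + 1) u * G u i j2) u := by
      intro i
      have := h.deriv i j1 (by simp [j1]; omega) u hu
      simpa [j1, j2] using this
    have p0 : 0 < G u (Fin.last m) j.castSucc := h.entry_pos' (Fin.le_last _) hu'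
    have p1 : 0 < G u (Fin.last m) j1 := h.entry_pos' (Fin.le_last _) hu'
    have p2 : 0 < G u (Fin.last m) j2 := h.entry_pos' (Fin.le_last _) hu'
    refine ((d0 i.castSucc).sub (((d0 (Fin.last m)).div (d1 (Fin.last m)) p1.ne').mul
      (d1 i.castSucc))).congr_deriv ?_
    have e0 : y j u = G u (Fin.last m) j.castSucc / G u (Fin.last m) j1 := by
      simp only [y, dif_pos j.2]; rfl
    have e1 : y (j + 1) u = G u (Fin.last m) j1 / G u (Fin.last m) j2 := by
      simp only [y, dif_pos hj]; rfl
    have e2 : GrassmannConvexity.eliminate (G u) i ⟨j + 1, hj⟩ =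
      G u i.castSucc j1 - G u (Fin.last m) j1 / G u (Fin.last m) j2 * G u i.castSucc j2 := rfl
    simp only [e0, e1, e2, Pi.div_apply]
    field_simp
    ring

end ConvexFromOne

lemma ConvexFromOne.mem_positiveCell {n : ℕ} {a b : ℝ} {G : ℝ → Matrix (Fin n) (Fin n) ℝ}
    {β : ℕ → ℝ → ℝ} (h : ConvexFromOne a b G β) {u : ℝ} (hu : u ∈ Set.Ioc a b) :
    G u ∈ positiveCell n := by
  induction n generalizing β with
  | zero => trivial
  | succ m ih =>
    obtain ⟨γ, hγ⟩ := h.eliminate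
    exact ⟨fun j => h.entry_pos' (Fin.le_last j) hu, ih hγ⟩

/-! ### Left translates of convex curves -/

/-- The entries of `L ∑ c_p 𝔩_p`. -/
lemma mul_sum_smul_subdiag {n : ℕ} (L : Matrix (Fin n) (Fin n) ℝ) (c : Fin (n - 1) → ℝ)
    (i j : Fin n) : (L * ∑ p, c p • subdiag n p) i j =
      if hj : (j : ℕ) + 1 < n then c ⟨j, by omega⟩ * L i ⟨j + 1, hj⟩ else 0 := by
  have hterm : ∀ p : Fin (n - 1), (L * (c p • subdiag n p)) i j =
      if (p : ℕ) = j then c p * L i ⟨p + 1, by omega⟩ else 0 := by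
    intro p
    rw [Matrix.mul_smul, Matrix.smul_apply, subdiag]
    by_cases hp : (p : ℕ) = j
    · have : j = ⟨p, by omega⟩ := Fin.ext hp.symm
      rw [if_pos hp, this, Matrix.mul_single_apply_same, mul_one, smul_eq_mul]
    · rw [if_neg hp, Matrix.mul_single_apply_of_ne _ _ _ _ _ (fun e => hp (by rw [e])), smul_zero]
  rw [Matrix.mul_sum, Matrix.sum_apply, Finset.sum_congr rfl fun p _ => hterm p]
  split_ifs with hj
  · rw [Finset.sum_eq_single ⟨j, by omega⟩]
    · simp
    · intro p _ hp
      exact if_neg fun e => hp (Fin.ext e)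
    · simp
  · exact Finset.sum_eq_zero fun p _ => if_neg (by omega)

/-- Left translation by `(Γ t)⁻¹` moves the starting point to the identity and leaves the
logarithmic derivative unchanged. -/
lemma IsConvexCurve.convexFromOne {n : ℕ} {a b : ℝ} {Γ : ℝ → Matrix (Fin n) (Fin n) ℝ}
    (h : IsConvexCurve a b Γ) {t t' : ℝ} (ht : t ∈ Set.Icc a b) (ht' : t' ∈ Set.Icc a b) :
    ∃ β, ConvexFromOne t t' (fun u => (Γ t)⁻¹ * Γ u) β := by
  obtain ⟨β, -, hpos, hβ⟩ := h.logDeriv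
  have hsub : Set.Icc t t' ⊆ Set.Icc a b := Set.Icc_subset_Icc ht.1 ht'.2
  have hu := isUnit_det_of_mem_unipotentLower (h.mem t ht)
  refine ⟨fun j u => if hj : j < n - 1 then β ⟨j, hj⟩ u else 0, ?_, ?_, ?_, ?_, ?_⟩
  · exact Matrix.nonsing_inv_mul _ hu
  · exact fun u hu => mul_mem_unipotentLower (inv_mem_unipotentLower (h.mem t ht))
      (h.mem u (hsub hu))
  · intro i j
    simp only [Matrix.mul_apply]
    exact continuousOn_finsetSum _ fun x _ =>
      continuousOn_const.mul ((h.smooth x j).continuousOn.mono hsub)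
  · intro j hj u hu
    rw [dif_pos (by omega)]
    exact hpos _ u (hsub (Set.Ioo_subset_Icc_self hu))
  · intro i j hj u hu
    have hu' := hsub (Set.Ioo_subset_Icc_self hu)
    have hd : ∀ x, HasDerivAt (fun s => Γ s x j) (β ⟨j, by omega⟩ u * Γ u x ⟨j + 1, hj⟩) u := by
      intro x
      have hnhds : Set.Icc a b ∈ nhds u := Icc_mem_nhds (ht.1.trans_lt hu.1) (hu.2.trans_le ht'.2)
      have h1 := ((h.smooth x j).differentiableOn (by simp)).differentiableAt hnhds
      have h2 := congrArg (fun X => (Γ u * X) x j) (hβ u hu')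
      beta_reduce at h2
      rw [Matrix.mul_nonsing_inv_cancel_left _ _ (isUnit_det_of_mem_unipotentLower (h.mem u hu')),
        mul_sum_smul_subdiag, dif_pos hj] at h2
      rw [← h2]
      simp only [curveDeriv, Matrix.of_apply]
      rw [derivWithin_of_mem_nhds hnhds]
      exact h1.hasDerivAt
    simp only [Matrix.mul_apply, Finset.mul_sum, dif_pos (show (j : ℕ) < n - 1 by omega)]
    refine (HasDerivAt.fun_sum fun x _ => (hd x).const_mul ((Γ t)⁻¹ i x)).congr_deriv ?_
    exact Finset.sum_congr rfl fun x _ => by ring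

lemma IsConvexCurve.inv_mul_mem_positiveCell {n : ℕ} {a b : ℝ}
    {Γ : ℝ → Matrix (Fin n) (Fin n) ℝ} (h : IsConvexCurve a b Γ) {t t' : ℝ}
    (ht : t ∈ Set.Icc a b) (ht' : t' ∈ Set.Icc a b) (htt' : t < t') :
    (Γ t)⁻¹ * Γ t' ∈ positiveCell n := by
  obtain ⟨β, hβ⟩ := h.convexFromOne ht ht'
  exact hβ.mem_positiveCell ⟨htt', le_rfl⟩

/-! ### Local sign changes of the lower left minor -/

/-- In `s` the determinant is the characteristic polynomial of `-X`, which is monic and so has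
finitely many roots. -/
lemma eventually_det_add_smul_one_ne_zero {k : ℕ} (X : Matrix (Fin k) (Fin k) ℝ) :
    ∀ᶠ s in nhdsWithin (0 : ℝ) {0}ᶜ, (X + s • (1 : Matrix (Fin k) (Fin k) ℝ)).det ≠ 0 := by
  have hfin : {s : ℝ | (-X).charpoly.IsRoot s}.Finite :=
    Polynomial.finite_setOfPred_isRoot (-X).charpoly_monic.ne_zero
  have h := (hfin.subset (Set.sdiff_subset (t := {0}))).isClosed.isOpen_compl.mem_nhds
    (x := (0 : ℝ)) (by simp)
  filter_upwards [mem_nhdsWithin_of_mem_nhds h, self_mem_nhdsWithin] with s hs hs0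
  intro hdet
  refine hs ⟨?_, hs0⟩
  change Polynomial.eval s (-X).charpoly = 0
  rw [Matrix.eval_charpoly, sub_neg_eq_add, add_comm, ← hdet]
  congr 2
  ext i j
  simp [Matrix.diagonal_apply, Matrix.one_apply]

/-- A multi-affine function that vanishes at the origin and is nonnegative near it vanishes near
it. -/
lemma eq_zero_of_multiaffine_of_nonneg {k : ℕ} {g : (Fin k → ℝ) → ℝ}
    (hg : ∀ x i, ∃ c, ∀ t, g (Function.update x i t) = g (Function.update x i 0) + t * c)
    (h0 : g 0 = 0) {δ : ℝ} (hδ : 0 < δ) (hnn : ∀ x, (∀ i, |x i| < δ) → 0 ≤ g x)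
    (x : Fin k → ℝ) (hx : ∀ i, |x i| < δ) : g x = 0 := by
  -- Induction on the set of coordinates allowed to be nonzero. In a new coordinate the function is
  -- affine, zero at 0 and nonnegative at `±δ/2`, so its slope is zero.
  suffices H : ∀ (S : Finset (Fin k)) (x : Fin k → ℝ), (∀ i, |x i| < δ) →
      (∀ i ∉ S, x i = 0) → g x = 0 from H Finset.univ x hx (by simp)
  intro S
  induction S using Finset.induction_on with
  | empty =>
    intro x _ h
    rw [show x = 0 from funext fun i => h i (by simp), h0]
  | insert i S hi ih =>
    intro x hx hS
    obtain ⟨c, hc⟩ := hg x i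
    have hsmall : ∀ t, |t| < δ → ∀ j, |Function.update x i t j| < δ := by
      intro t ht j
      rcases eq_or_ne j i with rfl | hj
      · simpa using ht
      · simpa [hj] using hx j
    have hz : g (Function.update x i 0) = 0 := by
      refine ih _ (hsmall 0 (by simpa using hδ)) fun j hj => ?_
      rcases eq_or_ne j i with rfl | hji
      · simp
      · simpa [hji] using hS j (by simp [hji, hj])
    have h1 := hnn _ (hsmall (δ / 2) (by rw [abs_of_pos (by linarith)]; linarith))
    have h2 := hnn _ (hsmall (-(δ / 2)) (by rw [abs_neg, abs_of_pos (by linarith)]; linarith))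
    rw [hc, hz] at h1 h2
    have hc0 : c = 0 := by nlinarith
    have h3 := hc (x i)
    rwa [Function.update_eq_self, hz, hc0, mul_zero, add_zero] at h3

lemma multiaffine_det_add_diagonal {k : ℕ} (X : Matrix (Fin k) (Fin k) ℝ) (x : Fin k → ℝ)
    (i : Fin k) : ∃ c, ∀ t, (X + Matrix.diagonal (Function.update x i t)).det =
      (X + Matrix.diagonal (Function.update x i 0)).det + t * c := by
  set A := X + Matrix.diagonal (Function.update x i 0) with hA
  refine ⟨(A.updateRow i (Pi.single i 1)).det, fun t => ?_⟩
  have h : X + Matrix.diagonal (Function.update x i t) =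
      A.updateRow i (A i + t • Pi.single i 1) := by
    ext p q
    rcases eq_or_ne p i with rfl | hp
    · simp [hA, Matrix.diagonal_apply, Pi.single_apply, eq_comm]
    · simp [hA, Matrix.diagonal_apply, hp]
  rw [h, Matrix.det_updateRow_add, Matrix.det_updateRow_smul, Matrix.updateRow_eq_self]

lemma frequently_det_add_diagonal_ne_zero {k : ℕ} (X : Matrix (Fin k) (Fin k) ℝ) :
    ∃ᶠ x in nhds (0 : Fin k → ℝ), (X + Matrix.diagonal x).det ≠ 0 := by
  have ht : Filter.Tendsto (fun s : ℝ => (fun _ : Fin k => s)) (nhdsWithin 0 {0}ᶜ)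
      (nhds (0 : Fin k → ℝ)) := by
    have : Continuous fun s : ℝ => (fun _ : Fin k => s) := by fun_prop
    exact (this.tendsto 0).mono_left nhdsWithin_le_nhds
  refine ht.frequently ((eventually_det_add_smul_one_ne_zero X).frequently.mono fun s hs => ?_)
  convert hs using 3
  ext i j
  simp [Matrix.diagonal_apply, Matrix.one_apply]

/-- Otherwise the determinant would have a constant weak sign near the origin. Being multi-affine in
the diagonal and zero at the origin, it would vanish identically nearby, contradicting
`frequently_det_add_diagonal_ne_zero`. -/
lemma frequently_mul_det_add_diagonal_pos {k : ℕ} (X : Matrix (Fin k) (Fin k) ℝ)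
    (hX : X.det = 0) {c : ℝ} (hc : c ≠ 0) :
    ∃ᶠ x in nhds (0 : Fin k → ℝ), 0 < c * (X + Matrix.diagonal x).det := by
  intro hev
  obtain ⟨δ, hδ, hball⟩ := Metric.eventually_nhds_iff.1 hev
  have hsmall : ∀ x : Fin k → ℝ, (∀ i, |x i| < δ) → dist x 0 < δ := by
    intro x hx
    rw [dist_zero_right]
    exact (pi_norm_lt_iff hδ).2 hx
  have hzero := eq_zero_of_multiaffine_of_nonneg
    (g := fun x => -(c * (X + Matrix.diagonal x).det))
    (fun x i => by
      obtain ⟨d, hd⟩ := multiaffine_det_add_diagonal X x i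
      exact ⟨-(c * d), fun t => by rw [hd]; ring⟩)
    (by simp [hX]) hδ (fun x hx => by have := hball (hsmall x hx); linarith)
  refine frequently_det_add_diagonal_ne_zero X ?_
  filter_upwards [Metric.ball_mem_nhds (0 : Fin k → ℝ) hδ] with x hx
  rw [Metric.mem_ball, dist_zero_right] at hx
  have := hzero x fun i => (pi_norm_lt_iff hδ).1 hx i
  simpa [hc] using this

/-- The `n × n` matrix whose lower left `k × k` block is `diag(x)`. -/
def lowerLeftDiagonal {k : ℕ} (n : ℕ) (x : Fin k → ℝ) : Matrix (Fin n) (Fin n) ℝ :=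
  Matrix.of fun i j => if h : (i : ℕ) = n - k + j ∧ (j : ℕ) < k then x ⟨j, h.2⟩ else 0

section lowerLeft
variable {k n : ℕ}

/-- Since `k < n`, the diagonal of the lower left block lies strictly below the main diagonal. Other
entries of the block need not be free when `2k > n`, which is why only diagonal perturbations are
used. -/
lemma add_lowerLeftDiagonal_mem (hkn : k < n) {W : Matrix (Fin n) (Fin n) ℝ}
    (hW : W ∈ unipotentLower n) (x : Fin k → ℝ) :
    W + lowerLeftDiagonal n x ∈ unipotentLower n := by
  refine ⟨fun i j hij => ?_, fun i => ?_⟩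
  · have : (i : ℕ) < j := hij
    rw [Matrix.add_apply, hW.1 i j hij, lowerLeftDiagonal, Matrix.of_apply, dif_neg (by omega),
      add_zero]
  · rw [Matrix.add_apply, hW.2, lowerLeftDiagonal, Matrix.of_apply, dif_neg (by omega), add_zero]

lemma minorBullet_add_lowerLeftDiagonal (hkn : k < n) (W : Matrix (Fin n) (Fin n) ℝ)
    (x : Fin k → ℝ) : minorBullet hkn.le (lastRows hkn.le (W + lowerLeftDiagonal n x)) =
      ((lastRows hkn.le W).submatrix id (Fin.castLEOrderEmb hkn.le) + Matrix.diagonal x).det := by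
  unfold minorBullet minor
  congr 1
  ext i j
  simp only [lastRows, lowerLeftDiagonal, Matrix.submatrix_apply, Matrix.add_apply,
    Matrix.of_apply, Matrix.diagonal_apply, id, Fin.castLEOrderEmb_apply, Fin.val_castLE, j.2,
    and_true, add_right_inj]
  split_ifs with h1 h2 h2
  · subst h2; rfl
  · exact absurd (Fin.ext (by omega)) h2
  · exact absurd (by rw [h2]) h1
  · rfl

lemma tendsto_add_lowerLeftDiagonal (W : Matrix (Fin n) (Fin n) ℝ) :
    Filter.Tendsto (fun x : Fin k → ℝ => W + lowerLeftDiagonal n x) (nhds 0) (nhds W) := by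
  have hc : Continuous fun x : Fin k → ℝ => W + lowerLeftDiagonal n x := by
    refine continuous_const.add (continuous_matrix fun i j => ?_)
    simp only [lowerLeftDiagonal, Matrix.of_apply]
    split_ifs <;> fun_prop
  have h0 : W + lowerLeftDiagonal n (0 : Fin k → ℝ) = W := by
    ext i j; simp [lowerLeftDiagonal]
  simpa only [h0] using hc.tendsto 0

lemma frequently_minorBullet_ne_zero (hkn : k < n) {W : Matrix (Fin n) (Fin n) ℝ}
    (hW : W ∈ unipotentLower n) : ∃ᶠ X in nhds W, X ∈ unipotentLower n ∧
      minorBullet hkn.le (lastRows hkn.le X) ≠ 0 :=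
  (tendsto_add_lowerLeftDiagonal W).frequently
    ((frequently_det_add_diagonal_ne_zero _).mono fun x hx =>
      ⟨add_lowerLeftDiagonal_mem hkn hW x, by rwa [minorBullet_add_lowerLeftDiagonal hkn]⟩)

lemma frequently_mul_minorBullet_pos (hkn : k < n) {W : Matrix (Fin n) (Fin n) ℝ}
    (hW : W ∈ unipotentLower n) (h0 : minorBullet hkn.le (lastRows hkn.le W) = 0) {c : ℝ}
    (hc : c ≠ 0) : ∃ᶠ X in nhds W, X ∈ unipotentLower n ∧
      0 < c * minorBullet hkn.le (lastRows hkn.le X) :=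
  (tendsto_add_lowerLeftDiagonal W).frequently
    ((frequently_mul_det_add_diagonal_pos _ h0 hc).mono fun x hx =>
      ⟨add_lowerLeftDiagonal_mem hkn hW x, by rwa [minorBullet_add_lowerLeftDiagonal hkn]⟩)

end lowerLeft

/-! ### Generic row selectors -/

lemma continuous_minor {k n : ℕ} (J : Fin k ↪o Fin n) : Continuous (minor J) :=
  (continuous_id.matrix_submatrix _ _).matrix_det

lemma isOpen_setOf_minor_mul_ne_zero {k n : ℕ} (J : Fin k ↪o Fin n)
    (T : Matrix (Fin n) (Fin n) ℝ) :
    IsOpen {E : Matrix (Fin k) (Fin n) ℝ | minor J (E * T) ≠ 0} :=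
  isOpen_ne_fun ((continuous_minor J).comp (continuous_id.matrix_mul continuous_const))
    continuous_const

lemma dense_setOf_minor_mul_ne_zero {k n : ℕ} (J : Fin k ↪o Fin n)
    {T : Matrix (Fin n) (Fin n) ℝ} (hT : IsUnit T.det) :
    Dense {E : Matrix (Fin k) (Fin n) ℝ | minor J (E * T) ≠ 0} := by
  intro E
  -- The direction `Y * T⁻¹` is chosen so that, after multiplication by `T`, the columns `J` of the
  -- perturbation form `s` times the identity.
  let Y : Matrix (Fin k) (Fin n) ℝ := Matrix.of fun i j => if J i = j then 1 else 0
  have ht : Filter.Tendsto (fun s : ℝ => E + s • (Y * T⁻¹)) (nhdsWithin 0 {0}ᶜ) (nhds E) := by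
    have hc : Continuous fun s : ℝ => E + s • (Y * T⁻¹) := by fun_prop
    have := (hc.tendsto 0).mono_left (nhdsWithin_le_nhds (s := {0}ᶜ))
    simpa only [zero_smul, add_zero] using this
  refine mem_closure_of_frequently_of_tendsto
    ((eventually_det_add_smul_one_ne_zero ((E * T).submatrix id J)).frequently.mono
      fun s hs => ?_) ht
  change minor J ((E + s • (Y * T⁻¹)) * T) ≠ 0
  convert hs using 1
  rw [Matrix.add_mul, Matrix.smul_mul, Matrix.nonsing_inv_mul_cancel_right _ _ hT]
  refine congrArg Matrix.det ?_
  ext i j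
  simp [Y, Matrix.one_apply]

lemma dense_setOf_mul_mem_generic {k n : ℕ} (ℓ : ℕ) {M : ℕ → Matrix (Fin n) (Fin n) ℝ}
    (hM : ∀ s ≤ ℓ, IsUnit (M s).det) :
    Dense {E : Matrix (Fin k) (Fin n) ℝ | ∀ s ≤ ℓ, E * M s ∈ generic k n} := by
  have : BaireSpace (Matrix (Fin k) (Fin n) ℝ) := inferInstanceAs (BaireSpace (Fin k → Fin n → ℝ))
  have h := dense_iInter_of_isOpen
    (f := fun p : Fin (ℓ + 1) × (Fin k ↪o Fin n) => {E | minor p.2 (E * M p.1) ≠ 0})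
    (fun p => isOpen_setOf_minor_mul_ne_zero _ _)
    (fun p => dense_setOf_minor_mul_ne_zero _ (hM _ (by omega)))
  refine h.mono fun E hE s hs J => ?_
  exact Set.mem_iInter.1 hE (⟨s, by omega⟩, J)

/-! ### From chains to sequences, and counting sign changes -/

lemma exists_seq_append_of_reflTransGen {α : Type*} {R : α → α → Prop} {ℓ : ℕ} {M : ℕ → α}
    (hM : ∀ s < ℓ, R (M s) (M (s + 1))) {x : α} (h : Relation.ReflTransGen R (M ℓ) x) :
    ∃ (ℓ' : ℕ) (M' : ℕ → α), ℓ ≤ ℓ' ∧ (∀ s ≤ ℓ, M' s = M s) ∧ M' ℓ' = x ∧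
      ∀ s < ℓ', R (M' s) (M' (s + 1)) := by
  induction h with
  | refl => exact ⟨ℓ, M, le_rfl, fun _ _ => rfl, rfl, hM⟩
  | @tail y z _ hyz ih =>
    obtain ⟨ℓ', M', hle, hag, hend, hR⟩ := ih
    refine ⟨ℓ' + 1, Function.update M' (ℓ' + 1) z, by omega, fun s hs => ?_, by simp,
      fun s hs => ?_⟩
    · rw [Function.update_of_ne (by omega), hag s hs]
    · rw [Function.update_of_ne (by omega)]
      rcases eq_or_ne s ℓ' with rfl | hne
      · rw [Function.update_self, hend]
        exact hyz
      · rw [Function.update_of_ne (by omega)]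
        exact hR s (by omega)

lemma exists_seq_of_reflTransGen {α : Type*} {R : α → α → Prop} (W : ℕ → α) (N : ℕ)
    (h : ∀ i < N, Relation.ReflTransGen R (W i) (W (i + 1))) :
    ∃ (ℓ : ℕ) (M : ℕ → α) (σ : ℕ → ℕ), (∀ s < ℓ, R (M s) (M (s + 1))) ∧
      (∀ i ≤ N, M (σ i) = W i) ∧ Monotone σ ∧ σ 0 = 0 ∧ ∀ i, σ i ≤ ℓ := by
  suffices H : ∃ (ℓ : ℕ) (M : ℕ → α) (σ : ℕ → ℕ), (∀ s < ℓ, R (M s) (M (s + 1))) ∧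
      (∀ i ≤ N, M (σ i) = W i) ∧ Monotone σ ∧ σ 0 = 0 ∧ (∀ i, σ i ≤ ℓ) ∧ M ℓ = W N by
    obtain ⟨ℓ, M, σ, h1, h2, h3, h4, h5, -⟩ := H
    exact ⟨ℓ, M, σ, h1, h2, h3, h4, h5⟩
  induction N with
  | zero =>
    exact ⟨0, fun _ => W 0, fun _ => 0, by simp, by simp, monotone_const, rfl, by simp, rfl⟩
  | succ N ih =>
    obtain ⟨ℓ, M, σ, h1, h2, h3, h4, h5, h6⟩ := ih fun i hi => h i (by omega)
    obtain ⟨ℓ', M', hle, hag, hend, hR⟩ :=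
      exists_seq_append_of_reflTransGen h1 (h6 ▸ h N (by omega))
    refine ⟨ℓ', M', fun i => if i ≤ N then σ i else ℓ', hR, fun i hi => ?_, ?_, by simp [h4],
      fun i => ?_, hend⟩
    · beta_reduce
      split_ifs with hiN
      · rw [hag _ (h5 i), h2 i hiN]
      · rw [hend, show i = N + 1 by omega]
    · refine monotone_nat_of_le_succ fun i => ?_
      split_ifs with ha hb
      · exact h3 (Nat.le_succ i)
      · exact (h5 i).trans hle
      · omega
      · exact le_rfl
    · beta_reduce
      split_ifs
      · exact (h5 i).trans hle
      · exact le_rfl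

lemma exists_consecutive_sign_change {f : ℕ → ℝ} {p q : ℕ} (hpq : p ≤ q)
    (hne : ∀ s ≤ q, f s ≠ 0) (h : f p * f q < 0) : ∃ s, p ≤ s ∧ s < q ∧ f s * f (s + 1) < 0 := by
  by_contra! hcon
  have key : ∀ s, p ≤ s → s ≤ q → 0 < f p * f s := by
    intro s hs
    induction s, hs using Nat.le_induction with
    | base => exact fun hq => mul_self_pos.2 (hne p hq)
    | succ s hs ih =>
      intro hq
      have h1 := ih (by omega)
      have h2 : 0 < f s * f (s + 1) :=
        lt_of_le_of_ne (hcon s hs (by omega))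
          (mul_ne_zero (hne _ (by omega)) (hne _ hq)).symm
      have h3 : 0 < f s * f s := mul_self_pos.2 (hne s (by omega))
      have h4 : 0 < (f p * f (s + 1)) * (f s * f s) := by
        calc 0 < (f p * f s) * (f s * f (s + 1)) := mul_pos h1 h2
          _ = _ := by ring
      exact pos_of_mul_pos_left h4 h3.le
  exact (key q hpq le_rfl).not_gt h

/-- Each block from `σ i` to `σ (i + 1)` contains a consecutive sign change, and the blocks are
disjoint. -/
lemma le_ncard_sign_changes {f : ℕ → ℝ} {σ : ℕ → ℕ} (hσ : Monotone σ) {N ℓ : ℕ}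
    (hℓ : ∀ i, σ i ≤ ℓ) (hne : ∀ s ≤ ℓ, f s ≠ 0)
    (h : ∀ i < N, f (σ i) * f (σ (i + 1)) < 0) :
    N ≤ {s : ℕ | s < ℓ ∧ f s * f (s + 1) < 0}.ncard := by
  have hex : ∀ i, ∃ s, i < N → σ i ≤ s ∧ s < σ (i + 1) ∧ f s * f (s + 1) < 0 := by
    intro i
    by_cases hi : i < N
    · obtain ⟨s, hs⟩ := exists_consecutive_sign_change (hσ (Nat.le_succ i))
        (fun s hs => hne s (hs.trans (hℓ _))) (h i hi)
      exact ⟨s, fun _ => hs⟩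
    · exact ⟨0, fun hi' => absurd hi' hi⟩
  choose g hg using hex
  have hlt : ∀ i j, i < j → j < N → g i < g j := fun i j hij hj =>
    ((hg i (hij.trans hj)).2.1.trans_le (hσ hij)).trans_le (hg j hj).1
  have hinj : Set.InjOn g (Set.Iio N) := by
    intro i hi j hj hij
    rcases lt_trichotomy i j with h1 | h1 | h1
    · exact absurd hij (hlt i j h1 hj).ne
    · exact h1
    · exact absurd hij (hlt j i h1 hi).ne'
  have hsub : g '' Set.Iio N ⊆ {s : ℕ | s < ℓ ∧ f s * f (s + 1) < 0} := by
    rintro _ ⟨i, hi, rfl⟩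
    exact ⟨(hg i hi).2.1.trans_le (hℓ _), (hg i hi).2.2⟩
  have hfin : {s : ℕ | s < ℓ ∧ f s * f (s + 1) < 0}.Finite :=
    (Set.finite_Iio ℓ).subset fun s hs => hs.1
  calc N = (Set.Iio N).ncard := by simp [Set.ncard_eq_toFinset_card']
    _ = (g '' Set.Iio N).ncard := hinj.ncard_image.symm
    _ ≤ _ := Set.ncard_le_ncard hsub hfin

/-! ### Many zeros of a convex curve yield many sign changes of a convex sequence -/

lemma ColumnMove.mem_unipotentLower {n : ℕ} {A B : Matrix (Fin n) (Fin n) ℝ}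
    (h : ColumnMove A B) (hA : A ∈ unipotentLower n) : B ∈ unipotentLower n := by
  obtain ⟨j, hj, t, -, h1, h2⟩ := h
  refine ⟨fun p q hpq => ?_, fun p => ?_⟩
  · by_cases hq : (q : ℕ) = j
    · subst hq
      rw [show B p q = _ from h1 p, hA.1 _ _ hpq, hA.1 _ _ (hpq.trans (by simp [Fin.lt_def]))]
      simp
    · rw [h2 q hq, hA.1 _ _ hpq]
  · by_cases hp : (p : ℕ) = j
    · subst hp
      rw [show B p p = _ from h1 p, hA.2, hA.1 _ _ (by simp [Fin.lt_def])]
      simp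
    · rw [h2 p hp, hA.2]

lemma lastRows_one_mul {k n : ℕ} (h : k ≤ n) (L : Matrix (Fin n) (Fin n) ℝ) :
    lastRows h 1 * L = lastRows h L := by
  ext i j
  simp [lastRows, Matrix.mul_apply, Matrix.one_apply]

lemma continuous_minorBullet {k n : ℕ} (h : k ≤ n) : Continuous (minorBullet (k := k) h) :=
  continuous_minor _

/-- A chain of unipotent matrices on which `m_•` alternates in sign gives a convex sequence in
`𝒞*` with that many sign changes. -/
lemma exists_convexSeq_of_chain {k n : ℕ} (hkn : k < n) {N : ℕ}
    {W : ℕ → Matrix (Fin n) (Fin n) ℝ} (hW : W 0 ∈ unipotentLower n)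
    (hreach : ∀ i < N, Reaches (W i) (W (i + 1)))
    (halt : ∀ i < N, minorBullet hkn.le (lastRows hkn.le (W i)) *
      minorBullet hkn.le (lastRows hkn.le (W (i + 1))) < 0) :
    ∃ (ℓ : ℕ) (M : ℕ → Matrix (Fin k) (Fin n) ℝ), (∀ s ≤ ℓ, M s ∈ generic k n) ∧
      IsConvexSeq ℓ M ∧ N ≤ nsc hkn.le ℓ M := by
  obtain ⟨ℓ, M, σ, hM, hMW, hσ, hσ0, hσℓ⟩ := exists_seq_of_reflTransGen W N hreach
  have hunip : ∀ s ≤ ℓ, M s ∈ unipotentLower n := by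
    intro s hs
    induction s with
    | zero => rw [← hσ0, hMW 0 (Nat.zero_le _)]; exact hW
    | succ s ih => exact (hM s (by omega)).mem_unipotentLower (ih (by omega))
  -- The strict alternation survives replacing the row selector by a nearby `E`; density then
  -- supplies such an `E` for which all maximal minors along the whole sequence are nonzero.
  have hopen : ∀ᶠ E in nhds (lastRows hkn.le (1 : Matrix (Fin n) (Fin n) ℝ)), ∀ i < N,
      minorBullet hkn.le (E * M (σ i)) * minorBullet hkn.le (E * M (σ (i + 1))) < 0 := by
    refine (Set.finite_Iio N).eventually_all.2 fun i hi => ?_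
    have hi : i < N := hi
    have hc : ∀ s, Continuous fun E : Matrix (Fin k) (Fin n) ℝ => minorBullet hkn.le (E * M s) := fun s =>
      (continuous_minorBullet hkn.le).comp (Continuous.matrix_mul continuous_id continuous_const)
    refine ((hc (σ i)).mul (hc (σ (i + 1)))).continuousAt.eventually_lt continuousAt_const ?_
    change minorBullet hkn.le (lastRows hkn.le 1 * M (σ i)) *
      minorBullet hkn.le (lastRows hkn.le 1 * M (σ (i + 1))) < 0
    rw [lastRows_one_mul, lastRows_one_mul, hMW i hi.le, hMW (i + 1) hi]
    exact halt i hi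
  obtain ⟨E, hEg, hEs⟩ := ((mem_closure_iff_frequently.1 (dense_setOf_mul_mem_generic (k := k) ℓ
    (fun s hs => isUnit_det_of_mem_unipotentLower (hunip s hs)) _)).and_eventually hopen).exists
  refine ⟨ℓ, fun s => E * M s, hEg, fun s hs => (hM s hs).mul_left E, ?_⟩
  exact le_ncard_sign_changes (f := fun s => minorBullet hkn.le (E * M s)) hσ hσℓ
    (fun s hs => hEg s hs _) hEs

/-- If consecutive points of a list in `Lo_n^1` are related through the positive cell and `m_•`
vanishes at all but the last, a small perturbation is a chain on which `m_•` alternates. -/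
lemma exists_alternating_chain {k n : ℕ} (hkn : k < n) (N : ℕ)
    {P : ℕ → Matrix (Fin n) (Fin n) ℝ} (hP : ∀ i, P i ∈ unipotentLower n)
    (hcell : ∀ i < N, (P i)⁻¹ * P (i + 1) ∈ positiveCell n)
    (hzero : ∀ i < N, minorBullet hkn.le (lastRows hkn.le (P i)) = 0) :
    ∃ W : ℕ → Matrix (Fin n) (Fin n) ℝ, (∀ i ≤ N, W i ∈ unipotentLower n) ∧
      (∀ i < N, Reaches (W i) (W (i + 1))) ∧
      ∀ i < N, minorBullet hkn.le (lastRows hkn.le (W i)) *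
        minorBullet hkn.le (lastRows hkn.le (W (i + 1))) < 0 := by
  have hreach : ∀ i, ∃ U ∈ nhds (P i), ∃ V ∈ nhds (P (i + 1)), i < N → ∀ X ∈ U, ∀ Y ∈ V,
      X ∈ unipotentLower n → Y ∈ unipotentLower n → Reaches X Y := by
    intro i
    by_cases hi : i < N
    · obtain ⟨U, hU, V, hV, hUV⟩ := Filter.mem_prod_iff.1 (eventually_reaches (hP i) (hcell i hi))
      exact ⟨U, hU, V, hV, fun _ X hX Y hY => hUV (Set.mk_mem_prod hX hY)⟩
    · exact ⟨_, Filter.univ_mem, _, Filter.univ_mem, fun h => absurd h hi⟩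
  choose U hU V hV hUV using hreach
  -- A point of `Z i` may serve both as the source of step `i` and as the target of step `i - 1`.
  let Z : ℕ → Set (Matrix (Fin n) (Fin n) ℝ) := fun i => U i ∩ {X | ∀ j, j + 1 = i → X ∈ V j}
  have hZ : ∀ i, Z i ∈ nhds (P i) := by
    intro i
    refine Filter.inter_mem (hU i) ?_
    cases i with
    | zero => exact Filter.mem_of_superset Filter.univ_mem fun X _ j hj => absurd hj (by omega)
    | succ i =>
      filter_upwards [hV i] with X hX j hj
      rwa [show j = i by omega]
  -- The last point, where `m_•` need not vanish, is perturbed before the others. Its sign dictates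
  -- all the others, through the factor `(-1) ^ (N - i)`.
  obtain ⟨Y, ⟨hYu, hY0⟩, hYZ⟩ :=
    ((frequently_minorBullet_ne_zero hkn (hP N)).and_eventually (hZ N)).exists
  set c := minorBullet hkn.le (lastRows hkn.le Y) with hc
  have hex : ∀ i, ∃ X, i ≤ N → X ∈ unipotentLower n ∧ X ∈ Z i ∧
      0 < ((-1) ^ (N - i) * c) * minorBullet hkn.le (lastRows hkn.le X) := by
    intro i
    rcases lt_trichotomy i N with hi | rfl | hi
    · obtain ⟨X, ⟨h1, h2⟩, h3⟩ := ((frequently_mul_minorBullet_pos hkn (hP i) (hzero i hi)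
        (c := (-1) ^ (N - i) * c) (mul_ne_zero (by simp) hY0)).and_eventually (hZ i)).exists
      exact ⟨X, fun _ => ⟨h1, h3, h2⟩⟩
    · refine ⟨Y, fun _ => ⟨hYu, hYZ, ?_⟩⟩
      rw [Nat.sub_self, pow_zero, one_mul]
      exact mul_self_pos.2 hY0
    · exact ⟨0, fun h => absurd h (by omega)⟩
  choose W hW using hex
  refine ⟨W, fun i hi => (hW i hi).1, fun i hi => ?_, fun i hi => ?_⟩
  · exact hUV i hi _ (hW i hi.le).2.1.1 _ ((hW (i + 1) hi).2.1.2 i rfl) (hW i hi.le).1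
      (hW (i + 1) hi).1
  · have h1 := (hW i hi.le).2.2
    have h2 := (hW (i + 1) hi).2.2
    rw [show N - i = N - (i + 1) + 1 by omega, pow_succ] at h1
    have h3 := mul_pos h1 h2
    set d := (-1 : ℝ) ^ (N - (i + 1)) * c
    by_contra! hcon
    nlinarith [mul_nonneg (mul_self_nonneg d) hcon]

lemma exists_convexSeq_of_lt_nz {k n r : ℕ} (hkn : k < n) {a b : ℝ} (hab : a < b)
    {Γ : ℝ → Matrix (Fin n) (Fin n) ℝ} (hΓ : IsConvexCurve a b Γ)
    (h : (r : ℕ∞) < nz (k := k) hkn.le a b Γ) :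
    ∃ (ℓ : ℕ) (M : ℕ → Matrix (Fin k) (Fin n) ℝ), (∀ s ≤ ℓ, M s ∈ generic k n) ∧
      IsConvexSeq ℓ M ∧ r + 1 ≤ nsc hkn.le ℓ M := by
  obtain ⟨T, hTsub, hTcard⟩ := Set.exists_subset_encard_eq (k := ((r + 1 : ℕ) : ℕ∞))
    (by push_cast; exact Order.add_one_le_of_lt h)
  have hTfin : T.Finite := Set.finite_of_encard_eq_coe hTcard
  have hcard : hTfin.toFinset.card = r + 1 := by
    rw [hTfin.encard_eq_coe_toFinset_card] at hTcard
    exact_mod_cast hTcard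
  let e := hTfin.toFinset.orderEmbOfFin hcard
  have he : ∀ i, e i ∈ Set.Icc a b ∧ minorBullet hkn.le (lastRows hkn.le (Γ (e i))) = 0 :=
    fun i => hTsub (hTfin.mem_toFinset.1 (Finset.orderEmbOfFin_mem _ _ i))
  have ha : a ∈ Set.Icc a b := ⟨le_rfl, hab.le⟩
  have hb : b ∈ Set.Icc a b := ⟨hab.le, le_rfl⟩
  -- The last chosen zero may be `b`, leaving no room further along the curve. The extra point is
  -- therefore obtained by multiplying by `(Γ a)⁻¹ * Γ b`, which lies in the cell; `r + 2` points
  -- give `r + 1` sign changes.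
  let P : ℕ → Matrix (Fin n) (Fin n) ℝ := fun i =>
    if hi : i < r + 1 then Γ (e ⟨i, hi⟩) else Γ (e (Fin.last r)) * ((Γ a)⁻¹ * Γ b)
  have hP1 : ∀ i (hi : i < r + 1), P i = Γ (e ⟨i, hi⟩) := fun i hi => dif_pos hi
  have hP2 : P (r + 1) = Γ (e (Fin.last r)) * ((Γ a)⁻¹ * Γ b) := dif_neg (by omega)
  have hPu : ∀ i, P i ∈ unipotentLower n := by
    intro i
    simp only [P]
    split_ifs
    · exact hΓ.mem _ (he _).1
    · exact mul_mem_unipotentLower (hΓ.mem _ (he _).1)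
        (mul_mem_unipotentLower (inv_mem_unipotentLower (hΓ.mem a ha)) (hΓ.mem b hb))
  have hcell : ∀ i < r + 1, (P i)⁻¹ * P (i + 1) ∈ positiveCell n := by
    intro i hi
    rcases eq_or_ne i r with rfl | hir
    · rw [hP1 i hi, hP2, show (⟨i, hi⟩ : Fin (i + 1)) = Fin.last i from rfl,
        Matrix.nonsing_inv_mul_cancel_left _ _
          (isUnit_det_of_mem_unipotentLower (hΓ.mem _ (he _).1))]
      exact hΓ.inv_mul_mem_positiveCell ha hb hab
    · rw [hP1 i hi, hP1 (i + 1) (by omega)]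
      exact hΓ.inv_mul_mem_positiveCell (he _).1 (he _).1
        (e.strictMono (by simp [Fin.lt_def]))
  obtain ⟨W, hWu, hWr, hWalt⟩ := exists_alternating_chain hkn (r + 1) hPu hcell
    (fun i hi => by rw [hP1 i hi]; exact (he _).2)
  exact exists_convexSeq_of_chain hkn (hWu 0 (Nat.zero_le _)) hWr hWalt

/-! ### Curves with prescribed logarithmic derivative -/

/-- The system is triangular, so it is solved by successive integrations starting from the highest
index, and joint continuity in the parameter is preserved at each integration. -/
lemma exists_triangular_solution (N : ℕ) (β : ℕ → ℝ → ℝ → ℝ)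
    (hβ : ∀ j, Continuous (Function.uncurry (β j))) (hβs : ∀ j ε, ContDiff ℝ ∞ (β j ε))
    (c : ℕ → ℝ) :
    ∃ F : ℕ → ℝ → ℝ → ℝ, (∀ j, Continuous (Function.uncurry (F j))) ∧
      (∀ j ε, ContDiff ℝ ∞ (F j ε)) ∧ (∀ j ε, F j ε 0 = c j) ∧
      ∀ j ε u, HasDerivAt (F j ε) (if j + 1 < N then β j ε u * F (j + 1) ε u else 0) u := by
  induction N generalizing β c with
  | zero =>
    refine ⟨fun j _ _ => c j, fun j => continuous_const, fun j ε => contDiff_const,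
      fun _ _ => rfl, fun j ε u => ?_⟩
    simpa using hasDerivAt_const u (c j)
  | succ N ih =>
    obtain ⟨F, hF1, hF2, hF3, hF4⟩ := ih (fun j => β (j + 1)) (fun j => hβ _)
      (fun j => hβs _) (fun j => c (j + 1))
    let g : ℝ → ℝ → ℝ := fun ε u => if 0 + 1 < N + 1 then β 0 ε u * F 0 ε u else 0
    have hg : Continuous (Function.uncurry g) := by
      by_cases hN : 0 + 1 < N + 1
      · simp only [g, if_pos hN]
        exact (hβ 0).mul (hF1 0)
      · simp only [g, if_neg hN]
        exact continuous_const
    have hgε : ∀ ε, Continuous (g ε) := fun ε => hg.comp (Continuous.prodMk_right ε)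
    have hgs : ∀ ε, ContDiff ℝ ∞ (g ε) := by
      intro ε
      by_cases hN : 0 + 1 < N + 1
      · simp only [g, if_pos hN]
        exact (hβs 0 ε).mul (hF2 0 ε)
      · simp only [g, if_neg hN]
        exact contDiff_const
    let F0 : ℝ → ℝ → ℝ := fun ε u => c 0 + ∫ v in (0 : ℝ)..u, g ε v
    have hF0 : ∀ ε u, HasDerivAt (F0 ε) (g ε u) u := fun ε u =>
      (intervalIntegral.integral_hasDerivAt_right ((hgε ε).intervalIntegrable _ _)
        ((hgε ε).stronglyMeasurableAtFilter _ _) (hgε ε).continuousAt).const_add (c 0)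
    refine ⟨fun j => Nat.casesOn j F0 F, ?_, ?_, ?_, ?_⟩
    · rintro (_ | j)
      · exact continuous_const.add
          (intervalIntegral.continuous_parametric_intervalIntegral_of_continuous
            (f := fun (p : ℝ × ℝ) v => g p.1 v)
            (hg.comp ((continuous_fst.comp continuous_fst).prodMk continuous_snd)) continuous_snd)
      · exact hF1 j
    · rintro (_ | j) ε
      · refine contDiff_infty_iff_deriv.2 ⟨fun u => (hF0 ε u).differentiableAt, ?_⟩
        change ContDiff ℝ ∞ (deriv (F0 ε))
        rw [show deriv (F0 ε) = g ε from funext fun u => (hF0 ε u).deriv]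
        exact hgs ε
      · exact hF2 j ε
    · rintro (_ | j) ε
      · simp [F0]
      · exact hF3 j ε
    · rintro (_ | j) ε u
      · exact hF0 ε u
      · simpa using hF4 j ε u

/-- `Γ` solves `Γ' = Γ ∑ β_j 𝔩_j` on the whole line. -/
def IsFlow {n : ℕ} (β : ℕ → ℝ → ℝ) (Γ : ℝ → Matrix (Fin n) (Fin n) ℝ) : Prop :=
  ∀ i j u, HasDerivAt (fun u => Γ u i j)
    (if hj : (j : ℕ) + 1 < n then β j u * Γ u i ⟨j + 1, hj⟩ else 0) u

lemma exists_isFlow {n : ℕ} (β : ℕ → ℝ → ℝ → ℝ)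
    (hβ : ∀ j, Continuous (Function.uncurry (β j))) (hβs : ∀ j ε, ContDiff ℝ ∞ (β j ε))
    (L : Matrix (Fin n) (Fin n) ℝ) :
    ∃ Γ : ℝ → ℝ → Matrix (Fin n) (Fin n) ℝ, Continuous (Function.uncurry Γ) ∧
      (∀ ε i j, ContDiff ℝ ∞ (fun u => Γ ε u i j)) ∧ (∀ ε, Γ ε 0 = L) ∧
      ∀ ε, IsFlow (fun j => β j ε) (Γ ε) := by
  choose F hF1 hF2 hF3 hF4 using fun i : Fin n => exists_triangular_solution n β hβ hβs
    (fun j => if hj : j < n then L i ⟨j, hj⟩ else 0)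
  refine ⟨fun ε u => Matrix.of fun i j => F i j ε u, ?_, fun ε i j => hF2 i j ε, fun ε => ?_,
    fun ε i j u => ?_⟩
  · exact continuous_matrix fun i j => hF1 i j
  · ext i j
    simp [hF3]
  · refine (hF4 i j ε u).congr_deriv ?_
    split_ifs <;> rfl

namespace IsFlow
variable {n : ℕ} {β : ℕ → ℝ → ℝ} {Γ : ℝ → Matrix (Fin n) (Fin n) ℝ}

lemma const_of_zero {i j : Fin n} (h : IsFlow β Γ)
    (h0 : ∀ (hj : (j : ℕ) + 1 < n) (u : ℝ), β j u * Γ u i ⟨j + 1, hj⟩ = 0) (u v : ℝ) :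
    Γ u i j = Γ v i j := by
  refine is_const_of_deriv_eq_zero (f := fun u => Γ u i j) (fun u => (h i j u).differentiableAt)
    (fun u => ?_) u v
  rw [(h i j u).deriv]
  split_ifs with hj
  · exact h0 hj u
  · rfl

lemma mem_unipotentLower (h : IsFlow β Γ) (h0 : Γ 0 ∈ unipotentLower n) (u : ℝ) :
    Γ u ∈ unipotentLower n := by
  -- Induction from the last column leftwards: the derivative of an entry above the diagonal is a
  -- multiple of its right neighbour, which is also above the diagonal.
  have hz : ∀ (d : ℕ) (i j : Fin n), n ≤ j + d → i < j → ∀ u, Γ u i j = 0 := by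
    intro d
    induction d with
    | zero => intro i j hd; have := j.2; omega
    | succ d ih =>
      intro i j hd hij u
      rw [← h0.1 i j hij]
      refine h.const_of_zero (fun hj v => ?_) u 0
      have hij' : (i : ℕ) < j := hij
      rw [ih i ⟨j + 1, hj⟩ (by simp; omega) (by simp [Fin.lt_def]; omega) v, mul_zero]
  refine ⟨fun i j hij => hz n i j (by omega) hij u, fun i => ?_⟩
  rw [← h0.2 i]
  refine h.const_of_zero (fun hj v => ?_) u 0
  rw [hz n i ⟨i + 1, hj⟩ (by simp) (by simp [Fin.lt_def]) v, mul_zero]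

lemma isConvexCurve (h : IsFlow β Γ) (h0 : Γ 0 ∈ unipotentLower n)
    (hs : ∀ i j, ContDiff ℝ ∞ (fun u => Γ u i j)) (hβs : ∀ j, ContDiff ℝ ∞ (β j))
    (hpos : ∀ j u, 0 < β j u) {a b : ℝ} (hab : a < b) : IsConvexCurve a b Γ := by
  refine ⟨fun t _ => h.mem_unipotentLower h0 t, fun i j => (hs i j).contDiffOn,
    fun j => β j, fun j => (hβs j).contDiffOn, fun j t _ => hpos j t, fun t ht => ?_⟩
  have hd : curveDeriv a b Γ t = Γ t * ∑ j : Fin (n - 1), β j t • subdiag n j := by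
    ext i j
    rw [mul_sum_smul_subdiag, curveDeriv, Matrix.of_apply]
    exact (h i j t).hasDerivWithinAt.derivWithin (uniqueDiffOn_Icc hab t ht)
  rw [hd, Matrix.nonsing_inv_mul_cancel_left _ _
    (isUnit_det_of_mem_unipotentLower (h.mem_unipotentLower h0 t))]

lemma sub_eq_integral (h : IsFlow β Γ) (hβ : ∀ j, Continuous (β j)) (i j : Fin n)
    (hj : (j : ℕ) + 1 < n) (a b : ℝ) :
    Γ b i j - Γ a i j = ∫ u in a..b, β j u * Γ u i ⟨j + 1, hj⟩ := by
  refine (intervalIntegral.integral_eq_sub_of_hasDerivAt (f := fun u => Γ u i j)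
    (fun u _ => ?_) ?_).symm
  · simpa only [dif_pos hj] using h i j u
  · refine ((hβ j).mul (continuous_iff_continuousAt.2 fun u => ?_)).intervalIntegrable _ _
    exact (h i ⟨j + 1, hj⟩ u).continuousAt

/-- Switching on only `β_p`, with total mass `t`, over an interval adds `t` times column `p + 1`
to column `p`. -/
lemma eq_of_single (h : IsFlow β Γ) (hβ : ∀ j, Continuous (β j)) {a b : ℝ} (hab : a ≤ b)
    {p : ℕ} (hp : p + 1 < n) {t : ℝ} (hint : ∫ u in a..b, β p u = t)
    (hzero : ∀ j, j ≠ p → ∀ u ∈ Set.Icc a b, β j u = 0) :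
    (∀ i, Γ b i ⟨p, by omega⟩ = Γ a i ⟨p, by omega⟩ + t * Γ a i ⟨p + 1, hp⟩) ∧
      ∀ j : Fin n, (j : ℕ) ≠ p → ∀ i, Γ b i j = Γ a i j := by
  have hconst : ∀ j : Fin n, (j : ℕ) ≠ p → ∀ i, ∀ u ∈ Set.Icc a b, Γ u i j = Γ a i j := by
    intro j hj i u hu
    by_cases hjn : (j : ℕ) + 1 < n
    · rw [← sub_eq_zero, h.sub_eq_integral hβ i j hjn,
        intervalIntegral.integral_congr (g := fun _ => 0), intervalIntegral.integral_zero]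
      intro v hv
      rw [Set.uIcc_of_le hu.1] at hv
      simp only [hzero j hj v ⟨hv.1, hv.2.trans hu.2⟩, zero_mul]
    · exact h.const_of_zero (fun hj' => absurd hj' hjn) _ _
  refine ⟨fun i => ?_, fun j hj i => hconst j hj i b ⟨hab, le_rfl⟩⟩
  rw [← sub_eq_iff_eq_add', h.sub_eq_integral hβ i ⟨p, by omega⟩ hp,
    intervalIntegral.integral_congr (g := fun u => β p u * Γ a i ⟨p + 1, hp⟩),
    intervalIntegral.integral_mul_const, hint]
  intro v hv
  rw [Set.uIcc_of_le hab] at hv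
  simp only [hconst ⟨p + 1, hp⟩ (by simp) i v hv]

end IsFlow

/-! ### Smoothing a convex sequence -/

lemma exists_unit_bump : ∃ φ : ℝ → ℝ, ContDiff ℝ ∞ φ ∧ (∀ x, 0 ≤ φ x) ∧ (∀ x ≤ 0, φ x = 0) ∧
    (∀ x, 1 ≤ x → φ x = 0) ∧ ∫ x in (0 : ℝ)..1, φ x = 1 := by
  let f : ContDiffBump (1 / 2 : ℝ) := ⟨1 / 4, 1 / 2, by norm_num, by norm_num⟩
  have hsupp : Function.support (f.normed MeasureTheory.volume) = Metric.ball (1 / 2 : ℝ) (1 / 2) :=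
    f.support_normed_eq
  have hball : Metric.ball (1 / 2 : ℝ) (1 / 2) = Set.Ioo 0 1 := by
    rw [Real.ball_eq_Ioo]; norm_num
  rw [hball] at hsupp
  have hz : ∀ x ∉ Set.Ioo (0 : ℝ) 1, f.normed MeasureTheory.volume x = 0 := by
    intro x hx
    rw [← hsupp] at hx
    exact Function.notMem_support.1 hx
  refine ⟨f.normed MeasureTheory.volume, f.contDiff_normed, f.nonneg_normed,
    fun x hx => hz x fun h => absurd h.1 hx.not_gt, fun x hx => hz x fun h => absurd h.2 hx.not_gt,
    ?_⟩
  rw [intervalIntegral.integral_eq_integral_of_support_subset, f.integral_normed]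
  rw [hsupp]
  exact Set.Ioo_subset_Ioc_self

/-- A sequence of column moves is the restriction to the integers of the member `ε = 0` of a
continuous family of curves whose members with `ε > 0` are convex. -/
lemma exists_family_of_moves {n : ℕ} {L : Matrix (Fin n) (Fin n) ℝ}
    (hL : L ∈ unipotentLower n) (ℓ : ℕ) (p : ℕ → ℕ) (t : ℕ → ℝ) (ht : ∀ s < ℓ, 0 < t s)
    (hp : ∀ s < ℓ, p s + 1 < n) :
    ∃ Γ : ℝ → ℝ → Matrix (Fin n) (Fin n) ℝ, Continuous (Function.uncurry Γ) ∧ Γ 0 0 = L ∧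
      (∀ ε > 0, ∀ a b, a < b → IsConvexCurve a b (Γ ε)) ∧
      ∀ s (hs : s < ℓ),
        (∀ i, Γ 0 (s + 1 : ℕ) i ⟨p s, (Nat.lt_succ_self _).trans (hp s hs)⟩ =
          Γ 0 s i ⟨p s, (Nat.lt_succ_self _).trans (hp s hs)⟩ +
            t s * Γ 0 s i ⟨p s + 1, hp s hs⟩) ∧
        ∀ j : Fin n, (j : ℕ) ≠ p s → ∀ i, Γ 0 (s + 1 : ℕ) i j = Γ 0 s i j := by
  obtain ⟨φ, hφs, hφ0, hφl, hφr, hφi⟩ := exists_unit_bump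
  -- At `ε = 0`, only `β_{p s}` is active on `[s, s + 1]`, with total mass `t s`; the summand `ε`
  -- makes every coefficient positive.
  let β : ℕ → ℝ → ℝ → ℝ := fun j ε u =>
    ε + ∑ s ∈ Finset.range ℓ, if p s = j then t s * φ (u - s) else 0
  have hβ : ∀ j, Continuous (Function.uncurry (β j)) := by
    intro j
    refine continuous_fst.add (continuous_finsetSum _ fun s _ => ?_)
    split_ifs
    · exact continuous_const.mul (hφs.continuous.comp (continuous_snd.sub continuous_const))
    · exact continuous_const
  have hβs : ∀ j ε, ContDiff ℝ ∞ (β j ε) := by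
    intro j ε
    refine contDiff_const.add (ContDiff.sum fun s _ => ?_)
    split_ifs
    · exact contDiff_const.mul (hφs.comp (contDiff_id.sub contDiff_const))
    · exact contDiff_const
  obtain ⟨Γ, h1, h2, h3, h4⟩ := exists_isFlow β hβ hβs L
  refine ⟨Γ, h1, h3 0, fun ε hε a b hab => ?_, fun s hs => ?_⟩
  · refine (h4 ε).isConvexCurve ((h3 ε).symm ▸ hL) (h2 ε) (fun j => hβs j ε) (fun j u => ?_) hab
    refine add_pos_of_pos_of_nonneg hε (Finset.sum_nonneg fun s hs => ?_)
    split_ifs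
    · exact mul_nonneg (ht s (Finset.mem_range.1 hs)).le (hφ0 _)
    · exact le_rfl
  · have hval : ∀ j, ∀ u ∈ Set.Icc (s : ℝ) ((s + 1 : ℕ) : ℝ),
        β j 0 u = if p s = j then t s * φ (u - s) else 0 := by
      intro j u hu
      push_cast at hu
      simp only [β, zero_add]
      refine Finset.sum_eq_single s (fun s' _ hs' => ?_) fun h =>
        absurd (Finset.mem_range.2 hs) h
      have hφz : φ (u - s') = 0 := by
        rcases lt_or_gt_of_ne hs' with h | h
        · have : (s' : ℝ) + 1 ≤ s := by exact_mod_cast h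
          exact hφr _ (by linarith [hu.1])
        · have : (s : ℝ) + 1 ≤ s' := by exact_mod_cast h
          exact hφl _ (by linarith [hu.2])
      rw [hφz, mul_zero, ite_self]
    have hle : (s : ℝ) ≤ ((s + 1 : ℕ) : ℝ) := by push_cast; linarith
    refine (h4 0).eq_of_single (fun j => (hβs j 0).continuous) hle (hp s hs) ?_
      fun j hj u hu => by rw [hval j u hu, if_neg hj.symm]
    rw [intervalIntegral.integral_congr (g := fun u => t s * φ (u - s))]
    · rw [intervalIntegral.integral_const_mul, intervalIntegral.integral_comp_sub_right]
      push_cast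
      rw [sub_self, add_sub_cancel_left, hφi, mul_one]
    · intro u hu
      rw [Set.uIcc_of_le hle] at hu
      simp only [hval _ u hu, if_true]

/-! ### Lifting generic `k × n` matrices to unipotent ones -/

lemma minorBullet_mul {k n : ℕ} (h : k ≤ n) (A : Matrix (Fin k) (Fin k) ℝ)
    (X : Matrix (Fin k) (Fin n) ℝ) : minorBullet h (A * X) = A.det * minorBullet h X := by
  unfold minorBullet minor
  rw [← Matrix.det_mul]
  rfl

/-- The order embedding onto the last `k` indices. -/
def lastEmb {k n : ℕ} (h : k ≤ n) : Fin k ↪o Fin n :=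
  OrderEmbedding.ofStrictMono (fun i => ⟨n - k + i, by omega⟩)
    fun i j hij => by
      have : (i : ℕ) < j := hij
      simp only [Fin.lt_def]
      omega

lemma exists_eq_lastEmb {k n : ℕ} (h : k ≤ n) {i : Fin n} (hi : n - k ≤ (i : ℕ)) :
    ∃ q : Fin k, i = lastEmb h q :=
  ⟨⟨i - (n - k), by omega⟩, Fin.ext (show (i : ℕ) = n - k + (i - (n - k)) by omega)⟩

/-- With `A` the last `k` columns of `M`, the last `k` columns of `A⁻¹ * M` form the identity.
Placing rows of the identity matrix above it therefore gives a unipotent lower triangular matrix. -/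
lemma exists_unipotent_of_generic {k n : ℕ} (h : k ≤ n) {M : Matrix (Fin k) (Fin n) ℝ}
    (hM : M ∈ generic k n) : ∃ (A : Matrix (Fin k) (Fin k) ℝ) (L : Matrix (Fin n) (Fin n) ℝ),
      A.det ≠ 0 ∧ L ∈ unipotentLower n ∧ M = A * lastRows h L := by
  have hA : IsUnit (M.submatrix id (lastEmb h)).det := isUnit_iff_ne_zero.2 (hM (lastEmb h))
  set A := M.submatrix id (lastEmb h) with hAdef
  let L : Matrix (Fin n) (Fin n) ℝ := Matrix.of fun i j =>
    if hi : n - k ≤ (i : ℕ) then (A⁻¹ * M) ⟨i - (n - k), by omega⟩ j else if i = j then 1 else 0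
  have hLlast : ∀ (q : Fin k) (j : Fin n), L (lastEmb h q) j = (A⁻¹ * M) q j := by
    intro q j
    have h1 : ((lastEmb h q : Fin n) : ℕ) = n - k + q := rfl
    simp only [L, Matrix.of_apply]
    rw [dif_pos (by omega)]
    exact congrArg (fun x => (A⁻¹ * M) x j)
      (Fin.ext (show n - k + (q : ℕ) - (n - k) = q by omega))
  have hlast : lastRows h L = A⁻¹ * M := by
    ext i j
    exact hLlast i j
  have hblock : ∀ i j : Fin k, (A⁻¹ * M) i (lastEmb h j) = if i = j then 1 else 0 := by
    intro i j
    have : (A⁻¹ * M) i (lastEmb h j) = (A⁻¹ * A) i j := rfl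
    rw [this, Matrix.nonsing_inv_mul _ hA, Matrix.one_apply]
  have hL : ∀ i j : Fin n, n - k ≤ (j : ℕ) → L i j = if i = j then 1 else 0 := by
    intro i j hj
    by_cases hi : n - k ≤ (i : ℕ)
    · obtain ⟨p, rfl⟩ := exists_eq_lastEmb h hi
      obtain ⟨q, rfl⟩ := exists_eq_lastEmb h hj
      rw [hLlast, hblock]
      simp
    · simp only [L, Matrix.of_apply]
      rw [dif_neg hi]
  refine ⟨A, L, hA.ne_zero, ⟨fun i j hij => ?_, fun i => ?_⟩, ?_⟩
  · by_cases hj : n - k ≤ (j : ℕ)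
    · rw [hL i j hj, if_neg hij.ne]
    · have : (i : ℕ) < j := hij
      simp only [L, Matrix.of_apply]
      rw [dif_neg (by omega), if_neg hij.ne]
  · by_cases hi : n - k ≤ (i : ℕ)
    · rw [hL i i hi, if_pos rfl]
    · simp only [L, Matrix.of_apply]
      rw [dif_neg hi]
      simp
  · rw [hlast, Matrix.mul_nonsing_inv_cancel_left _ _ hA]

lemma exists_zero_of_mul_neg {f : ℝ → ℝ} (hf : Continuous f) {a b : ℝ} (hab : a ≤ b)
    (h : f a * f b < 0) : ∃ z ∈ Set.Ioo a b, f z = 0 := by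
  have h0 : (0 : ℝ) ∈ Set.uIcc (f a) (f b) := by
    rw [Set.mem_uIcc]
    rcases mul_neg_iff.1 h with h | h
    · exact Or.inr ⟨h.2.le, h.1.le⟩
    · exact Or.inl ⟨h.1.le, h.2.le⟩
  obtain ⟨z, hz, hfz⟩ := intermediate_value_uIcc hf.continuousOn h0
  rw [Set.uIcc_of_le hab] at hz
  refine ⟨z, ⟨lt_of_le_of_ne hz.1 ?_, lt_of_le_of_ne hz.2 ?_⟩, hfz⟩
  · rintro rfl; simp [hfz] at h
  · rintro rfl; simp [hfz] at h

/-- Every convex sequence is followed by a convex curve with a zero for each sign change. -/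
lemma exists_isConvexCurve_nsc_le_nz {k n : ℕ} (hkn : k < n) (ℓ : ℕ)
    {M : ℕ → Matrix (Fin k) (Fin n) ℝ} (hM0 : M 0 ∈ generic k n) (hM : IsConvexSeq ℓ M) :
    ∃ (b : ℝ) (Γ : ℝ → Matrix (Fin n) (Fin n) ℝ), 0 < b ∧ IsConvexCurve 0 b Γ ∧
      (nsc hkn.le ℓ M : ℕ∞) ≤ nz (k := k) hkn.le 0 b Γ := by
  have hmove : ∀ s, ∃ (j : ℕ) (t : ℝ), s < ℓ → 0 < t ∧ ∃ hj : j + 1 < n,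
      (∀ i, M (s + 1) i ⟨j, by omega⟩ = M s i ⟨j, by omega⟩ + t * M s i ⟨j + 1, hj⟩) ∧
        ∀ j' : Fin n, (j' : ℕ) ≠ j → ∀ i, M (s + 1) i j' = M s i j' := by
    intro s
    by_cases hs : s < ℓ
    · obtain ⟨j, hj, t, ht, h1, h2⟩ := hM s hs
      exact ⟨j, t, fun _ => ⟨ht, hj, h1, h2⟩⟩
    · exact ⟨0, 0, fun h => absurd h hs⟩
  choose p t hpt using hmove
  obtain ⟨A, L, hA, hL, hML⟩ := exists_unipotent_of_generic hkn.le hM0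
  obtain ⟨Γ, hcont, hstart, hconv, hstep⟩ := exists_family_of_moves hL ℓ p t
    (fun s hs => (hpt s hs).1) (fun s hs => (hpt s hs).2.1)
  have hMΓ : ∀ s : ℕ, s ≤ ℓ → M s = A * lastRows hkn.le (Γ 0 s) := by
    intro s hs
    induction s with
    | zero => rw [Nat.cast_zero, hstart, hML]
    | succ s ih =>
      have ih := ih (by omega)
      obtain ⟨-, hj, h1, h2⟩ := hpt s hs
      obtain ⟨h3, h4⟩ := hstep s hs
      ext i j
      by_cases hjp : (j : ℕ) = p s
      · rw [show j = ⟨p s, by omega⟩ from Fin.ext hjp, h1, ih]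
        simp only [lastRows, Matrix.mul_apply, Matrix.submatrix_apply, id, h3, Finset.mul_sum,
          ← Finset.sum_add_distrib]
        exact Finset.sum_congr rfl fun x _ => by ring
      · rw [h2 j hjp, ih]
        simp only [lastRows, Matrix.mul_apply, Matrix.submatrix_apply, id, h4 j hjp]
  let f : ℝ → ℝ → ℝ := fun ε u => minorBullet hkn.le (lastRows hkn.le (Γ ε u))
  have hf : Continuous (Function.uncurry f) :=
    (continuous_minorBullet hkn.le).comp (hcont.matrix_submatrix _ _)
  have hev : ∀ᶠ ε in nhds (0 : ℝ), ∀ s < ℓ,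
      minorBullet hkn.le (M s) * minorBullet hkn.le (M (s + 1)) < 0 →
        f ε s * f ε (s + 1 : ℕ) < 0 := by
    refine (Set.finite_Iio ℓ).eventually_all.2 fun s hs => ?_
    have hs : s < ℓ := hs
    refine Filter.eventually_imp_distrib_left.2 fun hneg => ?_
    have hc : ∀ u, Continuous fun ε => f ε u := fun u => hf.comp (Continuous.prodMk_left u)
    refine ((hc s).mul (hc (s + 1 : ℕ))).continuousAt.eventually_lt continuousAt_const ?_
    rw [hMΓ s hs.le, hMΓ (s + 1) hs, minorBullet_mul, minorBullet_mul] at hneg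
    change f 0 s * f 0 (s + 1 : ℕ) < 0
    -- The factor `A.det` occurs in both minors, so it contributes a positive square and does not
    -- affect sign changes.
    have hsq : 0 < A.det * A.det := mul_self_pos.2 hA
    by_contra! hcon
    have := mul_nonneg hsq.le hcon
    simp only [f] at this
    linarith
  obtain ⟨ε, hε, hεpos⟩ := ((hev.filter_mono nhdsWithin_le_nhds).and
    (eventually_mem_nhdsWithin (s := Set.Ioi (0 : ℝ)))).exists
  -- The right endpoint is `ℓ + 1` rather than `ℓ`, so that the interval is nondegenerate even when
  -- `ℓ = 0`.
  refine ⟨ℓ + 1, Γ ε, by positivity, hconv ε hεpos _ _ (by positivity), ?_⟩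
  set S := {s : ℕ | s < ℓ ∧ minorBullet hkn.le (M s) * minorBullet hkn.le (M (s + 1)) < 0}
  have hSfin : S.Finite := (Set.finite_Iio ℓ).subset fun s hs => hs.1
  have hfε : Continuous (f ε) := hf.comp (Continuous.prodMk_right ε)
  have hzero : ∀ s : ℕ, ∃ z, s ∈ S → z ∈ Set.Ioo (s : ℝ) ((s + 1 : ℕ) : ℝ) ∧ f ε z = 0 := by
    intro s
    by_cases hs : s ∈ S
    · obtain ⟨z, hz⟩ := exists_zero_of_mul_neg hfε (by push_cast; linarith) (hε s hs.1 hs.2)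
      exact ⟨z, fun _ => hz⟩
    · exact ⟨0, fun h => absurd h hs⟩
  choose z hz using hzero
  -- The zeros lie in disjoint open unit intervals, so distinct sign changes give distinct zeros.
  have hinj : Set.InjOn z S := by
    intro s hs s' hs' he
    have h1 := (hz s hs).1
    have h2 := (hz s' hs').1
    rw [he] at h1
    have h3 : s < s' + 1 := by exact_mod_cast h1.1.trans h2.2
    have h4 : s' < s + 1 := by exact_mod_cast h2.1.trans h1.2
    omega
  calc (nsc hkn.le ℓ M : ℕ∞) = S.encard := hSfin.cast_ncard_eq
    _ = (z '' S).encard := hinj.encard_image.symm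
    _ ≤ _ := Set.encard_le_encard ?_
  rintro _ ⟨s, hs, rfl⟩
  obtain ⟨h1, h2⟩ := hz s hs
  have h3 : ((s + 1 : ℕ) : ℝ) ≤ ℓ := by exact_mod_cast hs.1
  exact ⟨⟨s.cast_nonneg.trans h1.1.le, by linarith [h1.2]⟩, h2⟩

end GrassmannConvexity

theorem lemma2p1 (k n r : ℕ) (hk : 0 < k) (hkn : k < n) :
    (∀ (ℓ : ℕ) (M : ℕ → Matrix (Fin k) (Fin n) ℝ),
        (∀ s ≤ ℓ, M s ∈ GrassmannConvexity.generic k n) →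
        GrassmannConvexity.IsConvexSeq ℓ M →
        GrassmannConvexity.nsc hkn.le ℓ M ≤ r) ↔
    (∀ (a b : ℝ) (Γ : ℝ → Matrix (Fin n) (Fin n) ℝ), a < b →
        GrassmannConvexity.IsConvexCurve a b Γ →
        GrassmannConvexity.nz (k := k) hkn.le a b Γ ≤ (r : ℕ∞)) := by
  refine ⟨fun h a b Γ hab hΓ => ?_, fun h ℓ M hgen hM => ?_⟩
  · by_contra! hlt
    obtain ⟨ℓ, M, h1, h2, h3⟩ := GrassmannConvexity.exists_convexSeq_of_lt_nz hkn hab hΓ hlt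
    have := h ℓ M h1 h2
    omega
  · obtain ⟨b, Γ, hb, hΓ, hle⟩ := GrassmannConvexity.exists_isConvexCurve_nsc_le_nz hkn ℓ
      (hgen 0 (Nat.zero_le _)) hM
    exact_mod_cast hle.trans (h 0 b Γ hb hΓ)
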